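/- Let $A=\mathbb{C}^{d_A}$ (with $d_A\ge 1$) and $B=\mathbb{C}^{d_B}$, let $\mathbb{L}(\cdot)$ denote the linear operators and $\mathbb{D}(\cdot)$ the density operators (positive semidefinite operators of unit trace), and let $\langle X,Y\rangle=\operatorname{Tr}(X^\dagger Y)$. Operator inequalities refer to the positive semidefinite order. Let $\Phi:\mathbb{L}(A)\to\mathbb{L}(B)$ be linear and Hermiticity-preserving, i.e. $\Phi(X)$ is Hermitian whenever $X$ is. Its Choi operator is $J_\Phi=(\mathrm{id}_A\otimes\Phi)[|\Omega\rangle\langle\Omega|]$ with $|\Omega\rangle=\sum_i|ii\rangle$; ${}^T$ is the transpose in the basis $\{|i\rangle\}$. A map $\Lambda:\mathbb{L}(A)\to\mathbb{L}(B)$ is in $\mathrm{CP}$ if $\mathrm{id}_A\otimes\Lambda$ is positive, and in $\mathrm{CPTNI}$ if moreover $\operatorname{Tr}\Lambda(X)\le\operatorname{Tr}X$ for all $X\ge 0$. Define $$\|\Phi\|_\diamond=\max_{\rho\in\mathbb{D}(A\otimes A)}\|(\mathrm{id}_A\otimes\Phi)(\rho)\|_1,$$ $$\|\Phi\|_{\mathrm{CPTNI}}=\min\{\lambda_++\lambda_-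 : \Phi=\lambda_+\Lambda_+-\lambda_-\Lambda_-,\ \Lambda_\pm\in\mathrm{CPTNI},\ \lambda_\pm\ge 0\},$$ $$R(\Phi)=\min\Big\{\lambda\ge 0 : \frac{\Phi+\lambda\Lambda}{1+\lambda}\in\mathrm{CPTNI},\ \Lambda\in\mathrm{CPTNI}\Big\},$$ $$R'(\Phi)=\min\{\lambda\ge -1 : J_\Phi\le(1+\lambda)J_\Lambda,\ \Lambda\in\mathrm{CPTNI}\},$$ $$R''(\Phi)=\min\{\lambda\ge 0 : \Phi+\lambda\Lambda\in\mathrm{CP},\ \Lambda\in\mathrm{CPTNI}\}.$$ Then all these extrema, and all the maxima below, are attained, and $$\|\Phi\|_\diamond=\max\{\langle J_\Phi,W\rangle : -\rho\otimes\mathbb{1}_B\le W\le\rho\otimes\mathbb{1}_B,\ \rho\in\mathbb{D}(A)\},$$ $$\|\Phi\|_{\mathrm{CPTNI}}=\max\{\langle J_\Phi,W\rangle : -\rho\otimes\mathbb{1}_B\le W\le\sigma\otimes\mathbb{1}_B,\ \rho,\sigma\in\mathbb{D}(A)\},$$ $$R(\Phi)=\max\{\langle J_\Phi,W\rangle-\operatorname{Tr}Y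 : -X\otimes\mathbb{1}_B\le W\le Y\otimes\mathbb{1}_B,\ X,Y\ge 0,\ \operatorname{Tr}(X+Y)=1\},$$ $$R'(\Phi)=\max\{\langle J_\Phi,W\rangle-1 : 0\le W\le\rho\otimes\mathbb{1}_B,\ \rho\in\mathbb{D}(A)\},$$ $$R''(\Phi)=\max\{\langle J_\Phi,W-\rho\otimes\mathbb{1}_B\rangle : 0\le W\le\rho\otimes\mathbb{1}_B,\ \rho\in\mathbb{D}(A)\}$$ $$\phantom{R''(\Phi)}=\max\{\langle J_\Phi,W\rangle-\operatorname{Tr}\Phi(\rho^T) : 0\le W\le\rho\otimes\mathbb{1}_B,\ \rho\in\mathbb{D}(A)\}.$$ -/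

import Mathlib

open scoped MatrixOrder ComplexOrder Kronecker

noncomputable section

namespace QuantumMap

variable {A B : Type*} [Fintype A] [DecidableEq A] [Fintype B] [DecidableEq B]

/-! Inequalities between matrices are taken in the Loewner order: `X ≤ Y` means that `Y - X` is
positive semidefinite (in particular Hermitian). -/

/-- The Hilbert-Schmidt inner product `⟨X, Y⟩ = Tr (X† Y)`. -/
def hsInner (X Y : Matrix A A ℂ) : ℂ := (X.conjTranspose * Y).trace

/-- Density operators: positive semidefinite operators of unit trace. -/
def IsDensity (ρ : Matrix A A ℂ) : Prop := 0 ≤ ρ ∧ ρ.trace = 1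

/-- The trace norm `‖X‖₁ = Tr √(X† X)`. -/
def traceNorm (X : Matrix A A ℂ) : ℝ := (CFC.sqrt (X.conjTranspose * X)).trace.re

/-- The linear map `Φ` sends Hermitian operators to Hermitian operators. -/
def IsHermiticityPreserving (Φ : Matrix A A ℂ →ₗ[ℂ] Matrix B B ℂ) : Prop :=
  ∀ X : Matrix A A ℂ, X.IsHermitian → (Φ X).IsHermitian

/-- The map `id_A ⊗ Φ` from operators on `A ⊗ A` to operators on `A ⊗ B`: `Φ` is applied to each
block (with respect to the first tensor factor), so that `E ⊗ X` is sent to `E ⊗ Φ X`. -/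
def idTensor (Φ : Matrix A A ℂ →ₗ[ℂ] Matrix B B ℂ) (Z : Matrix (A × A) (A × A) ℂ) :
    Matrix (A × B) (A × B) ℂ :=
  Matrix.of fun p q => Φ (Matrix.of fun k l => Z (p.1, k) (q.1, l)) p.2 q.2

/-- The unnormalised maximally entangled vector `∑ i, |i i⟩`. -/
def omegaVec (A : Type*) [DecidableEq A] : A × A → ℂ := fun p => if p.1 = p.2 then 1 else 0

/-- The Choi operator `J_Φ = (id_A ⊗ Φ) (|Ω⟩⟨Ω|)`. -/
def choi (Φ : Matrix A A ℂ →ₗ[ℂ] Matrix B B ℂ) : Matrix (A × B) (A × B) ℂ :=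
  idTensor Φ (Matrix.vecMulVec (omegaVec A) (star (omegaVec A)))

/-- Complete positivity: `id_A ⊗ Φ` is a positive map. -/
def IsCP (Φ : Matrix A A ℂ →ₗ[ℂ] Matrix B B ℂ) : Prop :=
  ∀ Z : Matrix (A × A) (A × A) ℂ, 0 ≤ Z → 0 ≤ idTensor Φ Z

/-- Completely positive maps that do not increase the trace of positive operators. -/
def IsCPTNI (Φ : Matrix A A ℂ →ₗ[ℂ] Matrix B B ℂ) : Prop :=
  IsCP Φ ∧ ∀ X : Matrix A A ℂ, 0 ≤ X → (Φ X).trace.re ≤ X.trace.re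

/-- The values `‖(id_A ⊗ Φ)(ρ)‖₁` over the states `ρ` of `A ⊗ A`. -/
def diamondSet (Φ : Matrix A A ℂ →ₗ[ℂ] Matrix B B ℂ) : Set ℝ :=
  {x | ∃ ρ : Matrix (A × A) (A × A) ℂ, IsDensity ρ ∧ x = traceNorm (idTensor Φ ρ)}

/-- The diamond norm (of a Hermiticity-preserving map). -/
def diamondNorm (Φ : Matrix A A ℂ →ₗ[ℂ] Matrix B B ℂ) : ℝ := sSup (diamondSet Φ)

/-- The values `s + t` over the decompositions `Φ = s Λ₁ - t Λ₂` with `s, t ≥ 0` and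
`Λ₁, Λ₂` completely positive and trace-non-increasing. -/
def baseSet (Φ : Matrix A A ℂ →ₗ[ℂ] Matrix B B ℂ) : Set ℝ :=
  {x | ∃ (s t : ℝ) (Λ₁ Λ₂ : Matrix A A ℂ →ₗ[ℂ] Matrix B B ℂ),
    0 ≤ s ∧ 0 ≤ t ∧ IsCPTNI Λ₁ ∧ IsCPTNI Λ₂ ∧ Φ = s • Λ₁ - t • Λ₂ ∧ x = s + t}

/-- The base norm with respect to the completely positive trace-non-increasing maps. -/
def baseNorm (Φ : Matrix A A ℂ →ₗ[ℂ] Matrix B B ℂ) : ℝ := sInf (baseSet Φ)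

/-- The feasible values for the robustness `R`. -/
def robSet (Φ : Matrix A A ℂ →ₗ[ℂ] Matrix B B ℂ) : Set ℝ :=
  {r | 0 ≤ r ∧ ∃ Λ : Matrix A A ℂ →ₗ[ℂ] Matrix B B ℂ,
    IsCPTNI Λ ∧ IsCPTNI ((1 + r)⁻¹ • (Φ + r • Λ))}

/-- The robustness `R`. -/
def rob (Φ : Matrix A A ℂ →ₗ[ℂ] Matrix B B ℂ) : ℝ := sInf (robSet Φ)

/-- The feasible values for the robustness `R'`; the weight `1 + r` is nonnegative. -/
def robSet' (Φ : Matrix A A ℂ →ₗ[ℂ] Matrix B B ℂ) : Set ℝ :=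
  {r | 0 ≤ 1 + r ∧ ∃ Λ : Matrix A A ℂ →ₗ[ℂ] Matrix B B ℂ,
    IsCPTNI Λ ∧ choi Φ ≤ (1 + r) • choi Λ}

/-- The robustness `R'`. -/
def rob' (Φ : Matrix A A ℂ →ₗ[ℂ] Matrix B B ℂ) : ℝ := sInf (robSet' Φ)

/-- The feasible values for the robustness `R''`. -/
def robSet'' (Φ : Matrix A A ℂ →ₗ[ℂ] Matrix B B ℂ) : Set ℝ :=
  {r | 0 ≤ r ∧ ∃ Λ : Matrix A A ℂ →ₗ[ℂ] Matrix B B ℂ, IsCPTNI Λ ∧ IsCP (Φ + r • Λ)}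

/-- The robustness `R''`. -/
def rob'' (Φ : Matrix A A ℂ →ₗ[ℂ] Matrix B B ℂ) : ℝ := sInf (robSet'' Φ)

end QuantumMap

end

open QuantumMap

set_option linter.unusedSectionVars false

/-! ### Loewner order: compactness, trace inequalities, sign and absolute value -/

namespace Matrix

variable {m n : Type*} [Fintype m] [Fintype n]

/-! The base norm, `R` and `R'` are instances of one semidefinite program. With `J` the Choi
operator, a decomposition of `Φ` amounts to a matrix `P ≥ 0` with `P ≥ J`: by Choi's theorem `P` and
`P - J` represent completely positive maps, and bounds on `Tr P (ρ ⊗ 1)` over densities `ρ` say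
which multiple of a CPTNI map each one is (`exists_isCPTNI_choi_eq_smul`). The dual variables are a
pair `(X, Y)` in a compact convex set `K`, together with `W` between `-X ⊗ 1` and `Y ⊗ 1`.

Strong duality is `exists_isGreatest_and_forall_le`. For a fixed pair, the shift of `W` by `X ⊗ 1`
leaves the maximum of `Tr J W` over `0 ≤ W ≤ Z`, which equals the infimum of `Tr P Z`. For
invertible `Z` both optima come from the positive part of `√Z J √Z`; singular `Z` follows by
perturbation and compactness. Sion's minimax theorem then yields one `P` that serves all pairs in
`K` up to `ε`, and compactness removes `ε`. Each quantity corresponds to a choice of `K`, and weak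
duality gives the reverse inequality. `R''` reduces to `R'` of `-Φ`.

The diamond norm needs only attainment of the dual maximum. A state of `A ⊗ A` is a sum of vectors
`(M ⊗ 1)|Ω⟩`, whose outputs are `(M ⊗ 1) J (M ⊗ 1)†`. Pairing with a contraction `S` and moving `M ⊗
1` onto `S` turns trace norms into feasible values `⟨J, W⟩`. Conversely, every feasible `W` factors
as `(M ⊗ 1)† S (M ⊗ 1)` and hence comes from a pure state. -/

theorem isClosed_setOf_nonneg : IsClosed {M : Matrix n n ℂ | 0 ≤ M} := by
  have : {M : Matrix n n ℂ | 0 ≤ M} =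
      {M | Mᴴ = M} ∩ ⋂ x : n → ℂ, {M | 0 ≤ star x ⬝ᵥ (M *ᵥ x)} := by
    ext M
    simp [nonneg_iff_posSemidef, posSemidef_iff_dotProduct_mulVec, IsHermitian]
  rw [this]
  refine (isClosed_eq (by fun_prop) (by fun_prop)).inter (isClosed_iInter fun x => ?_)
  exact isClosed_le continuous_const (by fun_prop)

theorem isClosed_setOf_le {E : Type*} [TopologicalSpace E] {f g : E → Matrix n n ℂ}
    (hf : Continuous f) (hg : Continuous g) : IsClosed {x | f x ≤ g x} := by
  simpa [Set.preimage] using isClosed_setOf_nonneg.preimage (hg.sub hf)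

theorem trace_conjTranspose_mul_self_re (V : Matrix m n ℂ) :
    (Vᴴ * V).trace.re = ∑ j, ∑ i, ‖V i j‖ ^ 2 := by
  simp only [trace, diag_apply, mul_apply, conjTranspose_apply, Complex.re_sum]
  refine Finset.sum_congr rfl fun j _ => Finset.sum_congr rfl fun i _ => ?_
  rw [Complex.sq_norm, Complex.normSq_apply]
  simp [Complex.mul_re]

theorem isCompact_setOf_trace_conjTranspose_mul_self_le (c : ℝ) :
    IsCompact {V : Matrix m n ℂ | (Vᴴ * V).trace.re ≤ c} := by
  have hbox : IsCompact (Set.pi Set.univ fun _ : m => Set.pi Set.univ fun _ : n =>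
      Metric.closedBall (0 : ℂ) (Real.sqrt c)) :=
    isCompact_univ_pi fun _ => isCompact_univ_pi fun _ => isCompact_closedBall _ _
  refine hbox.of_isClosed_subset (isClosed_le (by fun_prop) continuous_const)
    fun (V : Matrix m n ℂ) hV => ?_
  refine Set.mem_univ_pi.2 fun i => Set.mem_univ_pi.2 fun j => mem_closedBall_zero_iff.2 ?_
  refine Real.le_sqrt_of_sq_le (le_trans ?_ hV)
  rw [trace_conjTranspose_mul_self_re]
  refine (Finset.single_le_sum (f := fun i => ‖V i j‖ ^ 2) (fun i _ => by positivity)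
    (Finset.mem_univ i)).trans ?_
  exact Finset.single_le_sum (f := fun j => ∑ i, ‖V i j‖ ^ 2) (fun j _ => by positivity)
    (Finset.mem_univ j)

theorem exists_eq_conjTranspose_mul_self {W : Matrix n n ℂ} (hW : 0 ≤ W) :
    ∃ V : Matrix n n ℂ, W = Vᴴ * V := by
  classical
  exact CStarAlgebra.nonneg_iff_eq_star_mul_self.mp hW

/-- This set is the continuous image of a Hilbert-Schmidt ball under `V ↦ V† V`, so no separate
bound on the entries of `W` is needed. -/
theorem isCompact_setOf_nonneg_trace_le (c : ℝ) :
    IsCompact {W : Matrix n n ℂ | 0 ≤ W ∧ W.trace.re ≤ c} := by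
  convert (isCompact_setOf_trace_conjTranspose_mul_self_le (m := n) (n := n) c).image
    (f := fun V => Vᴴ * V) (by fun_prop) using 1
  ext W
  constructor
  · rintro ⟨h, hc⟩
    obtain ⟨V, rfl⟩ := exists_eq_conjTranspose_mul_self h
    exact ⟨V, hc, rfl⟩
  · rintro ⟨V, hV, rfl⟩
    exact ⟨(posSemidef_conjTranspose_mul_self V).nonneg, hV⟩

theorem trace_mul_re_nonneg {P W : Matrix n n ℂ} (hP : 0 ≤ P) (hW : 0 ≤ W) :
    0 ≤ (P * W).trace.re := by
  obtain ⟨V, rfl⟩ := exists_eq_conjTranspose_mul_self hW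
  rw [← mul_assoc, trace_mul_comm, ← mul_assoc]
  exact (Complex.nonneg_iff.1
    ((nonneg_iff_posSemidef.1 hP).mul_mul_conjTranspose_same V).trace_nonneg).1

theorem trace_mul_re_le {P W W' : Matrix n n ℂ} (hP : 0 ≤ P) (hW : W ≤ W') :
    (P * W).trace.re ≤ (P * W').trace.re := by
  have := trace_mul_re_nonneg hP (sub_nonneg.2 hW)
  simpa [mul_sub] using this

theorem trace_re_nonneg {P : Matrix n n ℂ} (hP : 0 ≤ P) : 0 ≤ P.trace.re :=
  (Complex.nonneg_iff.1 (nonneg_iff_posSemidef.1 hP).trace_nonneg).1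

theorem trace_re_le {P W : Matrix n n ℂ} (h : P ≤ W) : P.trace.re ≤ W.trace.re := by
  simpa using trace_re_nonneg (sub_nonneg.2 h)

theorem trace_eq_re {P : Matrix n n ℂ} (hP : 0 ≤ P) : P.trace = P.trace.re :=
  Complex.ext rfl (by
    simpa using (Complex.nonneg_iff.1 (nonneg_iff_posSemidef.1 hP).trace_nonneg).2.symm)

theorem eq_zero_of_nonneg_of_trace_re_le {P : Matrix n n ℂ} (hP : 0 ≤ P)
    (h : P.trace.re ≤ 0) : P = 0 := by
  have h0 : P.trace.re = 0 := le_antisymm h (trace_re_nonneg hP)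
  obtain ⟨V, rfl⟩ := exists_eq_conjTranspose_mul_self hP
  have h1 := trace_eq_re hP
  rw [h0, Complex.ofReal_zero] at h1
  rw [trace_conjTranspose_mul_self_eq_zero_iff.1 h1, mul_zero]

theorem smul_nonneg_real {n : Type*} {r : ℝ} (hr : 0 ≤ r) {P : Matrix n n ℂ} (hP : 0 ≤ P) :
    0 ≤ r • P := by
  have := ((nonneg_iff_posSemidef.1 hP).smul (a := (r : ℂ)) (by exact_mod_cast hr)).nonneg
  simpa using this

theorem smul_le_smul_real {n : Type*} {r : ℝ} (hr : 0 ≤ r) {P W : Matrix n n ℂ}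
    (h : P ≤ W) : r • P ≤ r • W := by
  have := smul_nonneg_real hr (sub_nonneg.2 h)
  rwa [smul_sub, sub_nonneg] at this

theorem kronecker_one_nonneg [DecidableEq m] {X : Matrix n n ℂ} (hX : 0 ≤ X) :
    0 ≤ X ⊗ₖ (1 : Matrix m m ℂ) :=
  ((nonneg_iff_posSemidef.1 hX).kronecker PosSemidef.one).nonneg

theorem conj_le_conj {X Y : Matrix n n ℂ} (h : X ≤ Y) (M : Matrix n m ℂ) :
    Mᴴ * X * M ≤ Mᴴ * Y * M := by
  have := ((nonneg_iff_posSemidef.1 (sub_nonneg.2 h)).conjTranspose_mul_mul_same M).nonneg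
  rwa [Matrix.mul_sub, Matrix.sub_mul, sub_nonneg] at this

theorem conj_nonneg {X : Matrix n n ℂ} (h : 0 ≤ X) (M : Matrix n m ℂ) :
    0 ≤ Mᴴ * X * M :=
  ((nonneg_iff_posSemidef.1 h).conjTranspose_mul_mul_same M).nonneg

/-- The continuous functional calculus sign of a Hermitian matrix. -/
theorem IsHermitian.exists_mul_eq_abs [DecidableEq n] {H : Matrix n n ℂ} (hH : H.IsHermitian) :
    ∃ S : Matrix n n ℂ, -1 ≤ S ∧ S ≤ 1 ∧ H * S = CFC.abs H := by
  have hs : IsSelfAdjoint H := hH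
  have hc : ∀ f : ℝ → ℝ, ContinuousOn f (spectrum ℝ H) := fun f =>
    (Set.toFinite _).continuousOn f
  have h1 : (1 : Matrix n n ℂ) = cfc (fun _ : ℝ => (1 : ℝ)) H := (cfc_const_one ℝ H).symm
  refine ⟨cfc (fun x : ℝ => if 0 ≤ x then 1 else -1) H, ?_, ?_, ?_⟩
  · rw [h1, ← cfc_neg]
    refine cfc_mono (fun x _ => ?_) (hc _) (hc _)
    split_ifs <;> norm_num
  · rw [h1]
    refine cfc_mono (fun x _ => ?_) (hc _) (hc _)
    split_ifs <;> norm_num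
  · nth_rewrite 1 [← cfc_id ℝ H]
    rw [← cfc_mul _ _ H (hc _) (hc _), CFC.abs_eq_cfc_norm H]
    refine cfc_congr fun x _ => ?_
    simp only [id, Real.norm_eq_abs]
    split_ifs with h
    · rw [abs_of_nonneg h, mul_one]
    · rw [abs_of_neg (not_le.1 h), mul_neg_one]

theorem IsHermitian.le_abs [DecidableEq n] {H : Matrix n n ℂ} (hH : H.IsHermitian) :
    H ≤ CFC.abs H ∧ -H ≤ CFC.abs H := by
  have hs : IsSelfAdjoint H := hH
  have hc : ∀ f : ℝ → ℝ, ContinuousOn f (spectrum ℝ H) := fun f =>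
    (Set.toFinite _).continuousOn f
  rw [CFC.abs_eq_cfc_norm H]
  constructor
  · nth_rewrite 1 [← cfc_id ℝ H]
    exact cfc_mono (fun x _ => le_abs_self x) (hc _) (hc _)
  · nth_rewrite 1 [← cfc_id ℝ H]
    rw [← cfc_neg]
    exact cfc_mono (fun x _ => neg_le_abs x) (hc _) (hc _)

end Matrix

/-- A closed condition that has solutions in a compact set for all small positive values of a
parameter has one for the value zero. -/
theorem IsCompact.exists_zero_of_forall_pos {E : Type*} [TopologicalSpace E] {C : Set E}
    (hC : IsCompact C) {G : Set (ℝ × E)} (hG : IsClosed G)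
    (h : ∀ ε : ℝ, 0 < ε → ε ≤ 1 → ∃ x ∈ C, (ε, x) ∈ G) : ∃ x ∈ C, ((0 : ℝ), x) ∈ G := by
  -- The good parameters in `[0, 1]` form a projection of a compact set, hence a closed set; it
  -- contains `(0, 1]` and therefore `0`.
  have hK : IsCompact (Prod.fst '' (Set.Icc (0 : ℝ) 1 ×ˢ C ∩ G)) :=
    ((isCompact_Icc.prod hC).inter_right hG).image continuous_fst
  have h0 : (0 : ℝ) ∈ closure (Set.Ioc (0 : ℝ) 1) := by
    rw [closure_Ioc zero_ne_one]; simp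
  have hsub : Set.Ioc (0 : ℝ) 1 ⊆ Prod.fst '' (Set.Icc (0 : ℝ) 1 ×ˢ C ∩ G) := fun ε hε => by
    obtain ⟨x, hx, hxG⟩ := h ε hε.1 hε.2
    exact ⟨(ε, x), ⟨⟨⟨hε.1.le, hε.2⟩, hx⟩, hxG⟩, rfl⟩
  obtain ⟨⟨ε, x⟩, ⟨⟨-, hx⟩, hxG⟩, rfl⟩ := closure_minimal hsub hK.isClosed h0
  exact ⟨x, hx, hxG⟩

/-! ### Duality for a single constraint `0 ≤ W ≤ Z`, and factorisation through contractions -/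

namespace Matrix

variable {m n : Type*} [Fintype m] [Fintype n]

theorem posDef_add_smul_one {n : Type*} [Finite n] [DecidableEq n] {Z : Matrix n n ℂ}
    (hZ : 0 ≤ Z) {ε : ℝ} (hε : 0 < ε) :
    (Z + ε • (1 : Matrix n n ℂ)).PosDef := by
  have h : (((ε : ℂ)) • (1 : Matrix n n ℂ)).PosDef := PosDef.one.smul (by exact_mod_cast hε)
  simpa using h.posSemidef_add (nonneg_iff_posSemidef.1 hZ)

theorem isUnit_sqrt_of_posDef [DecidableEq n] {Z : Matrix n n ℂ} (hZ : Z.PosDef) :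
    IsUnit (CFC.sqrt Z).det := by
  have h : CFC.sqrt Z * CFC.sqrt Z = Z := CFC.sqrt_mul_sqrt_self Z hZ.posSemidef.nonneg
  have h2 : IsUnit Z.det := (isUnit_iff_isUnit_det Z).1 hZ.isUnit
  rw [← h, det_mul] at h2
  exact isUnit_of_mul_isUnit_left h2

theorem isHermitian_sqrt [DecidableEq n] (Z : Matrix n n ℂ) : (CFC.sqrt Z)ᴴ = CFC.sqrt Z :=
  (nonneg_iff_posSemidef.1 (CFC.sqrt_nonneg Z)).isHermitian

/-- Conjugation by `R = √Z` reduces to `Z = 1`. With `H = R J R` and `S` its sign, the positive part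
is `(|H| + H) / 2 = H (1 + S) / 2`. The choices `P = R⁻¹ H₊ R⁻¹` and `W = R ((1 + S) / 2) R` are
feasible, and both traces equal `Tr H₊`, so they certify each other's optimality. -/
theorem exists_le_mul_of_posDef [DecidableEq n] {J Z : Matrix n n ℂ} (hJ : J.IsHermitian)
    (hZ : Z.PosDef) : ∃ P W : Matrix n n ℂ, 0 ≤ P ∧ J ≤ P ∧ 0 ≤ W ∧ W ≤ Z ∧
      (J * W).trace = (P * Z).trace := by
  set R := CFC.sqrt Z with hR
  have hRR : R * R = Z := CFC.sqrt_mul_sqrt_self Z hZ.posSemidef.nonneg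
  have hRH : Rᴴ = R := isHermitian_sqrt Z
  have hu : IsUnit R.det := isUnit_sqrt_of_posDef hZ
  have hl : R⁻¹ * R = 1 := nonsing_inv_mul R hu
  have hr : R * R⁻¹ = 1 := mul_nonsing_inv R hu
  have hiH : (R⁻¹)ᴴ = R⁻¹ := by rw [conjTranspose_nonsing_inv, hRH]
  have hH : (R * J * R).IsHermitian := by
    simp [IsHermitian, conjTranspose_mul, hRH, hJ.eq, mul_assoc]
  obtain ⟨S, hS1, hS2, hS⟩ := hH.exists_mul_eq_abs
  obtain ⟨ha, hb⟩ := hH.le_abs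
  set H := R * J * R with hHdef
  set T := CFC.abs H
  have half : (0 : ℝ) ≤ 1 / 2 := by norm_num
  have hP : 0 ≤ (1 / 2 : ℝ) • (T + H) :=
    smul_nonneg_real half (by rw [← sub_neg_eq_add]; exact sub_nonneg.2 hb)
  have hN : 0 ≤ (1 / 2 : ℝ) • (T - H) := smul_nonneg_real half (sub_nonneg.2 ha)
  have hJeq : J = R⁻¹ * H * R⁻¹ := by
    rw [hHdef, show R⁻¹ * (R * J * R) * R⁻¹ = (R⁻¹ * R) * J * (R * R⁻¹) by
      simp only [mul_assoc], hl, hr, one_mul, mul_one]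
  refine ⟨R⁻¹ * ((1 / 2 : ℝ) • (T + H)) * R⁻¹, R * ((1 / 2 : ℝ) • (1 + S)) * R, ?_, ?_, ?_, ?_, ?_⟩
  · simpa [hiH] using conj_nonneg hP R⁻¹
  · rw [← sub_nonneg]
    have h1 : R⁻¹ * ((1 / 2 : ℝ) • (T + H)) * R⁻¹ - J
        = R⁻¹ * ((1 / 2 : ℝ) • (T - H)) * R⁻¹ := by
      nth_rewrite 1 [hJeq]
      rw [← sub_mul, ← mul_sub]
      congr 2
      module
    rw [h1]
    simpa [hiH] using conj_nonneg hN R⁻¹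
  · have h1 : 0 ≤ (1 / 2 : ℝ) • (1 + S) :=
      smul_nonneg_real half (by simpa using add_le_add_right hS1 1)
    simpa [hRH] using conj_nonneg h1 R
  · have h1 : (1 / 2 : ℝ) • (1 + S) ≤ 1 := by
      have := smul_le_smul_real half (add_le_add_right hS2 (1 : Matrix n n ℂ))
      refine this.trans_eq ?_
      module
    simpa [hRH, hRR] using conj_le_conj h1 R
  · have h1 : (J * (R * ((1 / 2 : ℝ) • (1 + S)) * R)).trace =
        ((1 / 2 : ℝ) • (T + H)).trace := by
      rw [← mul_assoc, trace_mul_comm, ← hS, show R * (J * (R * ((1 / 2 : ℝ) • (1 + S))))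
        = H * ((1 / 2 : ℝ) • (1 + S)) by simp only [hHdef, mul_assoc], mul_smul_comm, mul_add,
        mul_one, add_comm]
    rw [h1, ← hRR, show R⁻¹ * ((1 / 2 : ℝ) • (T + H)) * R⁻¹ * (R * R) =
      R⁻¹ * ((1 / 2 : ℝ) • (T + H)) * ((R⁻¹ * R) * R) by simp only [mul_assoc], hl, one_mul,
      mul_assoc, trace_mul_comm, mul_assoc, hr, mul_one]

/-- Duality for the minimum of `Tr P Z` over `P ≥ 0`, `P ≥ J`. -/
theorem exists_le_trace_of_forall_le_trace [DecidableEq n] {J Z : Matrix n n ℂ}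
    (hJ : J.IsHermitian) (hZ : 0 ≤ Z) {t : ℝ}
    (h : ∀ P : Matrix n n ℂ, 0 ≤ P → J ≤ P → t ≤ (P * Z).trace.re) :
    ∃ W : Matrix n n ℂ, 0 ≤ W ∧ W ≤ Z ∧ t ≤ (J * W).trace.re := by
  have key := (isCompact_setOf_nonneg_trace_le (n := n)
    ((Z + (1 : ℝ) • (1 : Matrix n n ℂ)).trace.re)).exists_zero_of_forall_pos
    (G := {p : ℝ × Matrix n n ℂ | 0 ≤ p.2 ∧ p.2 ≤ Z + p.1 • (1 : Matrix n n ℂ) ∧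
      t ≤ (J * p.2).trace.re}) ?_ ?_
  · obtain ⟨W, -, h1, h2, h3⟩ := key
    exact ⟨W, h1, by simpa using h2, h3⟩
  · exact (isClosed_setOf_le continuous_const continuous_snd).inter
      ((isClosed_setOf_le (g := fun p : ℝ × Matrix n n ℂ => Z + p.1 • (1 : Matrix n n ℂ))
        continuous_snd (by fun_prop)).inter
        (isClosed_le (f := fun _ => t) (g := fun p : ℝ × Matrix n n ℂ => (J * p.2).trace.re)
          continuous_const (by fun_prop)))
  · intro ε hε hε1
    -- For the perturbed `Z`, the chain is `t ≤ Tr P Z ≤ Tr P (Z + ε) = Tr J W`. The bound `ε ≤ 1`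
    -- keeps all these `W` in one compact set.
    obtain ⟨P, W, hP, hJP, hW, hWZ, he⟩ := exists_le_mul_of_posDef hJ (posDef_add_smul_one hZ hε)
    refine ⟨W, ⟨hW, trace_re_le (hWZ.trans ?_)⟩, hW, hWZ, ?_⟩
    · have := smul_nonneg_real (sub_nonneg.2 hε1) (PosSemidef.one (n := n) (R := ℂ)).nonneg
      rw [sub_smul, sub_nonneg] at this
      exact add_le_add_right this Z
    · rw [he, mul_add, trace_add, Complex.add_re]
      have h1 := h P hP hJP
      have h2 := trace_mul_re_nonneg hP
        (smul_nonneg_real hε.le (PosSemidef.one (n := n) (R := ℂ)).nonneg)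
      linarith

/-- A matrix between `-ρ ⊗ 1` and `ρ ⊗ 1` is a contraction conjugated by some `M ⊗ 1`, where
`ρ = M† M`. -/
theorem exists_eq_conj_kronecker_of_posDef [DecidableEq m] [DecidableEq n] {ρ : Matrix n n ℂ}
    (hρ : ρ.PosDef) {W : Matrix (n × m) (n × m) ℂ} (h1 : -(ρ ⊗ₖ (1 : Matrix m m ℂ)) ≤ W)
    (h2 : W ≤ ρ ⊗ₖ (1 : Matrix m m ℂ)) :
    ∃ (M : Matrix n n ℂ) (S : Matrix (n × m) (n × m) ℂ), Mᴴ * M = ρ ∧ -1 ≤ S ∧ S ≤ 1 ∧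
      W = (M ⊗ₖ (1 : Matrix m m ℂ))ᴴ * S * (M ⊗ₖ (1 : Matrix m m ℂ)) := by
  set R := CFC.sqrt ρ with hR
  have hRR : R * R = ρ := CFC.sqrt_mul_sqrt_self ρ hρ.posSemidef.nonneg
  have hRH : Rᴴ = R := isHermitian_sqrt ρ
  have hu : IsUnit R.det := isUnit_sqrt_of_posDef hρ
  have hl : R⁻¹ * R = 1 := nonsing_inv_mul R hu
  have hr : R * R⁻¹ = 1 := mul_nonsing_inv R hu
  have hiH : (R⁻¹)ᴴ = R⁻¹ := by rw [conjTranspose_nonsing_inv, hRH]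
  set K := R ⊗ₖ (1 : Matrix m m ℂ) with hK
  set L := R⁻¹ ⊗ₖ (1 : Matrix m m ℂ) with hL
  have hKH : Kᴴ = K := by rw [hK, conjTranspose_kronecker, hRH, conjTranspose_one]
  have hLH : Lᴴ = L := by rw [hL, conjTranspose_kronecker, hiH, conjTranspose_one]
  have hLK : L * K = 1 := by
    rw [hK, hL, ← mul_kronecker_mul, hl, one_mul, one_kronecker_one]
  have hKL : K * L = 1 := by
    rw [hK, hL, ← mul_kronecker_mul, hr, one_mul, one_kronecker_one]
  have hρK : ρ ⊗ₖ (1 : Matrix m m ℂ) = K * K := by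
    rw [hK, ← mul_kronecker_mul, hRR, one_mul]
  have hone : L * (K * K) * L = 1 := by
    rw [← mul_assoc, hLK, one_mul, hKL]
  rw [hρK] at h1 h2
  refine ⟨R, L * W * L, by rw [hRH, hRR], ?_, ?_, ?_⟩
  · have := conj_le_conj h1 L
    rwa [hLH, mul_neg, neg_mul, hone] at this
  · have := conj_le_conj h2 L
    rwa [hLH, hone] at this
  · rw [← hK, hKH, show K * (L * W * L) * K = (K * L) * W * (L * K) by simp only [mul_assoc], hKL,
      hLK, one_mul, mul_one]

theorem isCompact_Icc_neg_one_one [DecidableEq n] :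
    IsCompact {S : Matrix n n ℂ | -1 ≤ S ∧ S ≤ 1} := by
  have h := ((isCompact_setOf_nonneg_trace_le (n := n) ((1 + 1 : Matrix n n ℂ).trace.re)).image
    (f := fun V => V - 1) (by fun_prop))
  refine h.of_isClosed_subset ((isClosed_setOf_le continuous_const continuous_id).inter
    (isClosed_setOf_le continuous_id continuous_const)) ?_
  rintro S ⟨h1, h2⟩
  exact ⟨S + 1, ⟨neg_le_iff_add_nonneg.1 h1, trace_re_le (add_le_add_left h2 1)⟩, by simp⟩

theorem continuous_kronecker_one {m n : Type*} [DecidableEq m] :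
    Continuous fun M : Matrix n n ℂ => M ⊗ₖ (1 : Matrix m m ℂ) := by
  refine continuous_matrix fun i j => ?_
  change Continuous fun M : Matrix n n ℂ => M i.1 j.1 * (1 : Matrix m m ℂ) i.2 j.2
  fun_prop

/-- Replacing `ρ` by `ρ + ε` only weakens the hypotheses on the fixed matrix `W`. The resulting `M`
have bounded Hilbert-Schmidt norm and the `S` lie in a compact interval, so the factorisation
survives `ε → 0`. -/
theorem exists_eq_conj_kronecker [DecidableEq m] [DecidableEq n] {ρ : Matrix n n ℂ}
    (hρ : 0 ≤ ρ) {W : Matrix (n × m) (n × m) ℂ} (h1 : -(ρ ⊗ₖ (1 : Matrix m m ℂ)) ≤ W)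
    (h2 : W ≤ ρ ⊗ₖ (1 : Matrix m m ℂ)) :
    ∃ (M : Matrix n n ℂ) (S : Matrix (n × m) (n × m) ℂ), Mᴴ * M = ρ ∧ -1 ≤ S ∧ S ≤ 1 ∧
      W = (M ⊗ₖ (1 : Matrix m m ℂ))ᴴ * S * (M ⊗ₖ (1 : Matrix m m ℂ)) := by
  have key := ((isCompact_setOf_trace_conjTranspose_mul_self_le
    (m := n) (n := n) ((ρ + (1 : ℝ) • (1 : Matrix n n ℂ)).trace.re)).prod
      (isCompact_Icc_neg_one_one (n := n × m))).exists_zero_of_forall_pos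
    (G := {p : ℝ × Matrix n n ℂ × Matrix (n × m) (n × m) ℂ |
      p.2.1ᴴ * p.2.1 = ρ + p.1 • (1 : Matrix n n ℂ) ∧ -1 ≤ p.2.2 ∧ p.2.2 ≤ 1 ∧
      W = (p.2.1 ⊗ₖ (1 : Matrix m m ℂ))ᴴ * p.2.2 * (p.2.1 ⊗ₖ (1 : Matrix m m ℂ))}) ?_ ?_
  · obtain ⟨⟨M, S⟩, -, h3, h4, h5, h6⟩ := key
    exact ⟨M, S, by simpa using h3, h4, h5, h6⟩
  · have hk : Continuous fun p : ℝ × Matrix n n ℂ × Matrix (n × m) (n × m) ℂ =>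
      p.2.1 ⊗ₖ (1 : Matrix m m ℂ) := continuous_kronecker_one.comp (by fun_prop)
    exact (isClosed_eq (by fun_prop) (by fun_prop)).inter
      ((isClosed_setOf_le continuous_const (by fun_prop)).inter
      ((isClosed_setOf_le (by fun_prop) continuous_const).inter
        (isClosed_eq continuous_const (by fun_prop))))
  · intro ε hε hε1
    have h0 : 0 ≤ (ε • (1 : Matrix n n ℂ)) ⊗ₖ (1 : Matrix m m ℂ) :=
      kronecker_one_nonneg (smul_nonneg_real hε.le (PosSemidef.one (n := n) (R := ℂ)).nonneg)
    have hle : ρ ⊗ₖ (1 : Matrix m m ℂ) ≤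
        (ρ + ε • (1 : Matrix n n ℂ)) ⊗ₖ (1 : Matrix m m ℂ) := by
      rw [add_kronecker]
      exact le_add_of_nonneg_right h0
    obtain ⟨M, S, h3, h4, h5, h6⟩ := exists_eq_conj_kronecker_of_posDef
      (posDef_add_smul_one hρ hε) ((neg_le_neg hle).trans h1) (h2.trans hle)
    refine ⟨(M, S), ⟨?_, h4, h5⟩, h3, h4, h5, h6⟩
    change (Mᴴ * M).trace.re ≤ _
    rw [h3]
    refine trace_re_le ?_
    have := smul_nonneg_real (sub_nonneg.2 hε1) (PosSemidef.one (n := n) (R := ℂ)).nonneg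
    rw [sub_smul, sub_nonneg] at this
    exact add_le_add_right this ρ

end Matrix

/-- A minimax principle: `X` is compact and convex, `Y` is convex, `f` is concave in the first
variable and convex in the second. -/
theorem IsCompact.exists_forall_lt_of_forall_exists_lt {E F : Type*}
    [TopologicalSpace E] [AddCommGroup E] [Module ℝ E] [IsTopologicalAddGroup E]
    [ContinuousSMul ℝ E] [TopologicalSpace F] [AddCommGroup F] [Module ℝ F]
    [IsTopologicalAddGroup F] [ContinuousSMul ℝ F] {X : Set E} {Y : Set F} {f : E → F → ℝ}
    (hX : IsCompact X) (hXne : X.Nonempty) (hXc : Convex ℝ X) (hYc : Convex ℝ Y)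
    (h1 : ∀ y ∈ Y, Continuous fun x => f x y) (h2 : ∀ y ∈ Y, ConcaveOn ℝ X fun x => f x y)
    (h3 : ∀ x ∈ X, Continuous fun y => f x y) (h4 : ∀ x ∈ X, ConvexOn ℝ Y fun y => f x y)
    {t : ℝ} (h : ∀ x ∈ X, ∃ y ∈ Y, f x y < t) : ∃ y ∈ Y, ∀ x ∈ X, f x y < t := by
  -- Finitely many of the open sets `{x | f x y < t}` cover `X`; the finite form of Sion's theorem,
  -- applied to `-f`, merges these `y` into a single one.
  obtain ⟨s, hsY, hs, hcov⟩ := hX.elim_finite_subcover_image (b := Y)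
    (c := fun y => {x | f x y < t}) (fun y hy => isOpen_lt (h1 y hy) continuous_const)
    (fun x hx => by simpa using h x hx)
  obtain ⟨y, hy, hlt⟩ := Sion.exists_lt_iInf_of_lt_iInf_of_finite (f := fun x y => -f x y)
    hXne hX (fun y hy => (h1 y hy).neg.continuousOn.lowerSemicontinuousOn)
    (fun y hy => (h2 y hy).neg.quasiconvexOn) hYc
    (fun x hx => (h3 x hx).neg.continuousOn.upperSemicontinuousOn)
    (fun x hx => (h4 x hx).neg.quasiconcaveOn) hXc hs hsY (t := -t)
    (fun x hx => by simpa using hcov hx)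
  exact ⟨y, hy, fun x hx => neg_lt_neg_iff.1 (hlt x hx)⟩

/-! ### Strong duality for the common semidefinite program -/

namespace Matrix

variable {A B : Type*} [Fintype A] [DecidableEq A] [Fintype B] [DecidableEq B]

theorem convex_setOf_nonneg_and_le {A : Type*} (J : Matrix A A ℂ) :
    Convex ℝ {P : Matrix A A ℂ | 0 ≤ P ∧ J ≤ P} := by
  rintro P ⟨hP, hJP⟩ Q ⟨hQ, hJQ⟩ a b ha hb hab
  refine ⟨add_nonneg (smul_nonneg_real ha hP) (smul_nonneg_real hb hQ), ?_⟩
  calc J = a • J + b • J := by rw [← add_smul, hab, one_smul]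
    _ ≤ _ := add_le_add (smul_le_smul_real ha hJP) (smul_le_smul_real hb hJQ)

/-- Strong duality for the semidefinite programs whose dual variables are a compact convex set `K`
of pairs of positive matrices, and `W` with `-X ⊗ 1 ≤ W ≤ Y ⊗ 1` for a pair `(X, Y)` in `K`. -/
theorem exists_isGreatest_and_forall_le {J : Matrix (A × B) (A × B) ℂ} (hJ : J.IsHermitian)
    {K : Set (Matrix A A ℂ × Matrix A A ℂ)} (hK : IsCompact K) (hKc : Convex ℝ K)
    (hpos : ∀ k ∈ K, 0 ≤ k.1 ∧ 0 ≤ k.2) {c : ℝ} (hc : 0 < c)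
    (hcK : ∃ k ∈ K, k.1 + k.2 = c • (1 : Matrix A A ℂ)) (a : ℝ) :
    ∃ m, IsGreatest {x : ℝ | ∃ W : Matrix (A × B) (A × B) ℂ, ∃ k ∈ K,
        -(k.1 ⊗ₖ (1 : Matrix B B ℂ)) ≤ W ∧ W ≤ k.2 ⊗ₖ (1 : Matrix B B ℂ) ∧
        x = (J * W).trace.re - a * k.2.trace.re} m ∧
      ∃ P, 0 ≤ P ∧ J ≤ P ∧ ∀ k ∈ K, (P * (k.2 ⊗ₖ (1 : Matrix B B ℂ))).trace.re +
        ((P - J) * (k.1 ⊗ₖ (1 : Matrix B B ℂ))).trace.re - a * k.2.trace.re ≤ m := by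
  have hk : Continuous fun M : Matrix A A ℂ => M ⊗ₖ (1 : Matrix B B ℂ) :=
    continuous_kronecker_one
  obtain ⟨k₀, hk₀, hk₀c⟩ := hcK
  -- the maximum
  obtain ⟨C, hC⟩ : ∃ C, ∀ k ∈ K, ((k.1 + k.2) ⊗ₖ (1 : Matrix B B ℂ)).trace.re ≤ C := by
    have hcont : Continuous fun k : Matrix A A ℂ × Matrix A A ℂ =>
        ((k.1 + k.2) ⊗ₖ (1 : Matrix B B ℂ)).trace.re := by
      have := hk.comp (continuous_fst.add continuous_snd)
      simp only [Function.comp_def] at this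
      fun_prop
    obtain ⟨C, hC⟩ := (hK.image hcont).bddAbove
    exact ⟨C, fun k hk => hC ⟨k, hk, rfl⟩⟩
  have hk1 : Continuous fun p : Matrix (A × B) (A × B) ℂ × Matrix A A ℂ × Matrix A A ℂ =>
    p.2.1 ⊗ₖ (1 : Matrix B B ℂ) := hk.comp (by fun_prop)
  have hk2 : Continuous fun p : Matrix (A × B) (A × B) ℂ × Matrix A A ℂ × Matrix A A ℂ =>
    p.2.2 ⊗ₖ (1 : Matrix B B ℂ) := hk.comp (by fun_prop)
  -- Here the first coordinate stands for `W + X ⊗ 1`. The shift makes it positive, so its size is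
  -- controlled by its trace.
  have hTc : IsCompact {p : Matrix (A × B) (A × B) ℂ × Matrix A A ℂ × Matrix A A ℂ |
      p.2 ∈ K ∧ 0 ≤ p.1 ∧ p.1 ≤ p.2.1 ⊗ₖ (1 : Matrix B B ℂ) + p.2.2 ⊗ₖ (1 : Matrix B B ℂ)} := by
    convert ((isCompact_setOf_nonneg_trace_le (n := A × B) C).prod hK).inter_right
      (isClosed_setOf_le continuous_fst (hk1.add hk2)) using 1
    ext ⟨W, k⟩
    constructor
    · rintro ⟨h1, h2, h3⟩
      refine ⟨⟨⟨h2, ?_⟩, h1⟩, h3⟩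
      have h4 := trace_re_le h3
      simp only [← add_kronecker] at h4
      exact h4.trans (hC k h1)
    · rintro ⟨⟨⟨h2, -⟩, h1⟩, h3⟩
      exact ⟨h1, h2, h3⟩
  obtain ⟨⟨W₀, k₁⟩, ⟨hk₁, hW₀, hW₀'⟩, hmax⟩ := hTc.exists_isMaxOn (f := fun p =>
      (J * (p.1 - p.2.1 ⊗ₖ (1 : Matrix B B ℂ))).trace.re - a * p.2.2.trace.re)
    ⟨(0, k₀), hk₀, le_rfl, add_nonneg (kronecker_one_nonneg (hpos k₀ hk₀).1)
      (kronecker_one_nonneg (hpos k₀ hk₀).2)⟩ (Continuous.continuousOn (by fun_prop))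
  set m := (J * (W₀ - k₁.1 ⊗ₖ (1 : Matrix B B ℂ))).trace.re - a * k₁.2.trace.re with hm
  have hub : ∀ (W : Matrix (A × B) (A × B) ℂ), ∀ k ∈ K, -(k.1 ⊗ₖ (1 : Matrix B B ℂ)) ≤ W →
      W ≤ k.2 ⊗ₖ (1 : Matrix B B ℂ) → (J * W).trace.re - a * k.2.trace.re ≤ m := by
    intro W k hkK h1 h2
    have := hmax (show (W + k.1 ⊗ₖ (1 : Matrix B B ℂ), k) ∈ _ from
      ⟨hkK, neg_le_iff_add_nonneg.1 h1, by
        simpa only [add_comm] using add_le_add_left h2 (k.1 ⊗ₖ (1 : Matrix B B ℂ))⟩)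
    simpa using this
  refine ⟨m, ⟨⟨W₀ - k₁.1 ⊗ₖ (1 : Matrix B B ℂ), k₁, hk₁, ?_, ?_, rfl⟩, ?_⟩, ?_⟩
  · rw [neg_le_iff_add_nonneg, sub_add_cancel]
    exact hW₀
  · exact sub_le_iff_le_add'.2 hW₀'
  · rintro x ⟨W, k, hkK, h1, h2, rfl⟩
    exact hub W k hkK h1 h2
  -- the primal solution
  set v : Matrix A A ℂ × Matrix A A ℂ → Matrix (A × B) (A × B) ℂ → ℝ := fun k P =>
    (P * (k.2 ⊗ₖ (1 : Matrix B B ℂ))).trace.re +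
        ((P - J) * (k.1 ⊗ₖ (1 : Matrix B B ℂ))).trace.re - a * k.2.trace.re with hv
  have hv1 : ∀ P, Continuous fun k => v k P := fun P => by
    have hk1 : Continuous fun p : Matrix A A ℂ × Matrix A A ℂ =>
      p.1 ⊗ₖ (1 : Matrix B B ℂ) := hk.comp (by fun_prop)
    have hk2 : Continuous fun p : Matrix A A ℂ × Matrix A A ℂ =>
      p.2 ⊗ₖ (1 : Matrix B B ℂ) := hk.comp (by fun_prop)
    simp only [hv]
    fun_prop
  have hv2 : ∀ k, Continuous fun P => v k P := fun k => by
    simp only [hv]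
    fun_prop
  -- Minimax: `v` is affine in each variable, so it suffices to find, for each pair in `K`
  -- separately, a feasible `P` with value below `m + ε`.
  have hex : ∀ ε : ℝ, 0 < ε → ∃ P, (0 ≤ P ∧ J ≤ P) ∧ ∀ k ∈ K, v k P < m + ε := by
    intro ε hε
    refine hK.exists_forall_lt_of_forall_exists_lt (Y := {P | 0 ≤ P ∧ J ≤ P}) (f := v)
      ⟨k₀, hk₀⟩ hKc (convex_setOf_nonneg_and_le J) (fun P _ => hv1 P) (fun P _ => ⟨hKc, ?_⟩)
      (fun k _ => hv2 k) (fun k _ => ⟨convex_setOf_nonneg_and_le J, ?_⟩) ?_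
    · intro k _ l _ p q _ _ _
      refine le_of_eq ?_
      simp only [hv, Prod.fst_add, Prod.snd_add, Prod.smul_fst, Prod.smul_snd, add_kronecker,
        smul_kronecker, mul_add, Matrix.mul_smul, trace_add, trace_smul, Complex.add_re,
        Complex.smul_re, smul_eq_mul]
      ring
    · intro P _ Q _ p q _ _ hpq
      refine le_of_eq ?_
      simp only [hv, add_mul, sub_mul, smul_mul, trace_add, trace_sub, trace_smul, Complex.add_re,
        Complex.sub_re, Complex.smul_re, smul_eq_mul]
      linear_combination (-(J * (k.1 ⊗ₖ (1 : Matrix B B ℂ))).trace.re - a * k.2.trace.re) * (-hpq)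
    · intro k hkK
      by_contra! hcon
      -- If no `P` worked for this pair, duality with `Z = (X + Y) ⊗ 1` would produce a dual
      -- feasible `W` of value at least `m + ε`, above the maximum `m`.
      have hW := exists_le_trace_of_forall_le_trace hJ
        (Z := k.1 ⊗ₖ (1 : Matrix B B ℂ) + k.2 ⊗ₖ (1 : Matrix B B ℂ))
        (add_nonneg (kronecker_one_nonneg (hpos k hkK).1) (kronecker_one_nonneg (hpos k hkK).2))
        (t := m + ε + (J * (k.1 ⊗ₖ (1 : Matrix B B ℂ))).trace.re + a * k.2.trace.re) ?_
      · obtain ⟨W, hW1, hW2, hW3⟩ := hW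
        have := hub (W - k.1 ⊗ₖ (1 : Matrix B B ℂ)) k hkK
          (by rw [neg_le_iff_add_nonneg, sub_add_cancel]; exact hW1) (sub_le_iff_le_add'.2 hW2)
        rw [mul_sub, trace_sub, Complex.sub_re] at this
        linarith
      · intro P hP hJP
        have := hcon P ⟨hP, hJP⟩
        simp only [hv, sub_mul, trace_sub, Complex.sub_re] at this
        rw [mul_add, trace_add, Complex.add_re]
        linarith
  -- The pair `k₀`, whose sum is `c • 1`, gives coercivity: its inequality bounds `c * Tr P`, which
  -- confines the near-optimal `P` to a compact set.
  have key := (isCompact_setOf_nonneg_trace_le (n := A × B)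
      ((m + 1 + (J * (k₀.1 ⊗ₖ (1 : Matrix B B ℂ))).trace.re + a * k₀.2.trace.re) / c)
      ).exists_zero_of_forall_pos
    (G := {p : ℝ × Matrix (A × B) (A × B) ℂ | (0 ≤ p.2 ∧ J ≤ p.2) ∧
      ∀ k ∈ K, v k p.2 ≤ m + p.1}) ?_ ?_
  · obtain ⟨P, -, ⟨h1, h2⟩, h3⟩ := key
    exact ⟨P, h1, h2, fun k hk => (h3 k hk).trans_eq (add_zero m)⟩
  · refine ((isClosed_setOf_le continuous_const continuous_snd).inter
      (isClosed_setOf_le continuous_const continuous_snd)).inter ?_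
    have hcl : IsClosed (⋂ k ∈ K, {p : ℝ × Matrix (A × B) (A × B) ℂ | v k p.2 ≤ m + p.1}) :=
      isClosed_biInter fun k _ => isClosed_le ((hv2 k).comp continuous_snd) (by fun_prop)
    have heq : {p : ℝ × Matrix (A × B) (A × B) ℂ | ∀ k ∈ K, v k p.2 ≤ m + p.1} =
        ⋂ k ∈ K, {p : ℝ × Matrix (A × B) (A × B) ℂ | v k p.2 ≤ m + p.1} := by
      ext p
      simp only [Set.mem_iInter]
      rfl
    rw [← heq] at hcl
    exact hcl
  · intro ε hε hε1
    obtain ⟨P, hP, hlt⟩ := hex ε hε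
    refine ⟨P, ⟨hP.1, ?_⟩, hP, fun k hk => (hlt k hk).le⟩
    have h1 := hlt k₀ hk₀
    have h2 : (P * (k₀.1 ⊗ₖ (1 : Matrix B B ℂ))).trace.re +
        (P * (k₀.2 ⊗ₖ (1 : Matrix B B ℂ))).trace.re = c * P.trace.re := by
      rw [← Complex.add_re, ← trace_add, ← mul_add, ← add_kronecker, hk₀c, smul_kronecker,
        one_kronecker_one, Matrix.mul_smul, mul_one, trace_smul, Complex.smul_re, smul_eq_mul]
    simp only [hv, sub_mul, trace_sub, Complex.sub_re] at h1
    rw [le_div_iff₀ hc]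
    linarith

end Matrix

/-! ### Choi operators, complete positivity and density matrices -/

namespace QuantumMap

open Matrix

variable {A B : Type*} [Fintype A] [DecidableEq A] [Fintype B] [DecidableEq B]

theorem choi_apply {A B : Type*} [DecidableEq A] (Φ : Matrix A A ℂ →ₗ[ℂ] Matrix B B ℂ) (p q : A × B) :
    choi Φ p q = Φ (Matrix.single p.1 q.1 1) p.2 q.2 := by
  have h : (Matrix.of fun k l => Matrix.vecMulVec (omegaVec A) (star (omegaVec A))
      (p.1, k) (q.1, l)) = Matrix.single p.1 q.1 (1 : ℂ) := by
    ext k l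
    by_cases h1 : p.1 = k <;> by_cases h2 : q.1 = l <;>
      simp [Matrix.vecMulVec_apply, omegaVec, h1, h2]
  simp only [choi, idTensor, Matrix.of_apply]
  rw [h]

theorem apply_eq_sum_choi (Φ : Matrix A A ℂ →ₗ[ℂ] Matrix B B ℂ) (X : Matrix A A ℂ) (b b' : B) :
    Φ X b b' = ∑ k, ∑ l, X k l * choi Φ (k, b) (l, b') := by
  conv_lhs => rw [matrix_eq_sum_single X]
  simp only [map_sum, Matrix.sum_apply, choi_apply]
  refine Finset.sum_congr rfl fun k _ => Finset.sum_congr rfl fun l _ => ?_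
  rw [← mul_one (X k l), ← smul_eq_mul, ← Matrix.smul_single, map_smul]
  simp

theorem choi_injective {Φ Ψ : Matrix A A ℂ →ₗ[ℂ] Matrix B B ℂ} (h : choi Φ = choi Ψ) : Φ = Ψ := by
  refine LinearMap.ext fun X => ?_
  ext b b'
  rw [apply_eq_sum_choi, apply_eq_sum_choi, h]

theorem choi_add (Φ Ψ : Matrix A A ℂ →ₗ[ℂ] Matrix B B ℂ) : choi (Φ + Ψ) = choi Φ + choi Ψ := by
  ext p q
  simp [choi_apply]

theorem choi_sub (Φ Ψ : Matrix A A ℂ →ₗ[ℂ] Matrix B B ℂ) : choi (Φ - Ψ) = choi Φ - choi Ψ := by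
  ext p q
  simp [choi_apply]

theorem choi_neg (Φ : Matrix A A ℂ →ₗ[ℂ] Matrix B B ℂ) : choi (-Φ) = -choi Φ := by
  ext p q
  simp [choi_apply]

theorem choi_smul (r : ℝ) (Φ : Matrix A A ℂ →ₗ[ℂ] Matrix B B ℂ) :
    choi (r • Φ) = r • choi Φ := by
  ext p q
  simp [choi_apply]

/-- The linear map with a given Choi operator. -/
def ofChoi (P : Matrix (A × B) (A × B) ℂ) : Matrix A A ℂ →ₗ[ℂ] Matrix B B ℂ where
  toFun X := Matrix.of fun b b' => ∑ k, ∑ l, X k l * P (k, b) (l, b')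
  map_add' X Y := by
    ext b b'
    simp [add_mul, Finset.sum_add_distrib]
  map_smul' c X := by
    ext b b'
    simp [mul_assoc, Finset.mul_sum]

theorem choi_ofChoi (P : Matrix (A × B) (A × B) ℂ) : choi (ofChoi P) = P := by
  ext ⟨a, b⟩ ⟨a', b'⟩
  rw [choi_apply]
  simp [ofChoi, Matrix.single_apply, ite_and]

theorem IsHermiticityPreserving.map_conjTranspose {Φ : Matrix A A ℂ →ₗ[ℂ] Matrix B B ℂ}
    (hΦ : IsHermiticityPreserving Φ) (X : Matrix A A ℂ) : Φ Xᴴ = (Φ X)ᴴ := by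
  -- The Hermitian matrices `X + X†` and `i (X - X†)` determine `X`; the hypothesis for both is
  -- combined entrywise.
  have h1 := hΦ (X + Xᴴ) (by simp [IsHermitian, add_comm])
  have h2 := hΦ (Complex.I • (X - Xᴴ)) (by
    rw [IsHermitian, conjTranspose_smul, conjTranspose_sub, conjTranspose_conjTranspose]
    simp only [Complex.star_def, Complex.conj_I]
    module)
  rw [IsHermitian] at h1 h2
  rw [map_add, conjTranspose_add] at h1
  rw [map_smul, conjTranspose_smul, map_sub, conjTranspose_sub] at h2
  ext i j
  have e1 := congr_fun₂ h1 i j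
  have e2 := congr_fun₂ h2 i j
  simp only [Matrix.add_apply, Matrix.sub_apply, Matrix.smul_apply, smul_eq_mul, Complex.star_def,
    Complex.conj_I] at e1 e2
  have e3 : -((Φ X)ᴴ i j - (Φ Xᴴ)ᴴ i j) = Φ X i j - Φ Xᴴ i j :=
    mul_left_cancel₀ Complex.I_ne_zero (by linear_combination e2)
  linear_combination (-1 / 2) * e1 + (1 / 2) * e3

theorem IsHermiticityPreserving.isHermitian_choi {Φ : Matrix A A ℂ →ₗ[ℂ] Matrix B B ℂ}
    (hΦ : IsHermiticityPreserving Φ) : (choi Φ).IsHermitian := by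
  ext p q
  rw [conjTranspose_apply, choi_apply, choi_apply, ← conjTranspose_apply, ← hΦ.map_conjTranspose]
  simp

theorem kronecker_one_mul_apply (M : Matrix A A ℂ) (P : Matrix (A × B) (A × B) ℂ) (a : A) (b : B)
    (q : A × B) : ((M ⊗ₖ (1 : Matrix B B ℂ)) * P) (a, b) q = ∑ k, M a k * P (k, b) q := by
  simp [Matrix.mul_apply, Matrix.one_apply, Fintype.sum_prod_type]

theorem mul_kronecker_one_conjTranspose_apply (M : Matrix A A ℂ) (P : Matrix (A × B) (A × B) ℂ)
    (p : A × B) (a : A) (b : B) :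
    (P * (M ⊗ₖ (1 : Matrix B B ℂ))ᴴ) p (a, b) = ∑ l, P p (l, b) * star (M a l) := by
  simp [Matrix.mul_apply, Matrix.one_apply, Fintype.sum_prod_type, apply_ite]

/-- Each column of `R`, reshaped into a matrix `M`, is the vector `(M ⊗ 1)|Ω⟩`. Since `M` acts on
the factor that `Φ` leaves alone, it can be pulled out of `id ⊗ Φ`. -/
theorem idTensor_mul_conjTranspose {ι : Type*} [Fintype ι] (Φ : Matrix A A ℂ →ₗ[ℂ] Matrix B B ℂ)
    (R : Matrix (A × A) ι ℂ) :
    idTensor Φ (R * Rᴴ) = ∑ j, ((Matrix.of fun a k => R (a, k) j) ⊗ₖ (1 : Matrix B B ℂ)) * choi Φ *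
      ((Matrix.of fun a k => R (a, k) j) ⊗ₖ (1 : Matrix B B ℂ))ᴴ := by
  ext ⟨a, b⟩ ⟨a', b'⟩
  simp only [idTensor, Matrix.of_apply, apply_eq_sum_choi, Matrix.sum_apply,
    mul_kronecker_one_conjTranspose_apply, kronecker_one_mul_apply, Matrix.mul_apply (M := R),
    conjTranspose_apply, Finset.sum_mul]
  rw [Finset.sum_congr rfl fun k _ => Finset.sum_comm, Finset.sum_comm]
  refine Finset.sum_congr rfl fun j _ => ?_
  rw [Finset.sum_comm]
  refine Finset.sum_congr rfl fun l _ => Finset.sum_congr rfl fun k _ => ?_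
  ring

/-- Choi's theorem: one direction tests on `|Ω⟩⟨Ω|`, the other writes the output as a sum of
conjugates of the Choi operator. -/
theorem isCP_iff (Φ : Matrix A A ℂ →ₗ[ℂ] Matrix B B ℂ) : IsCP Φ ↔ 0 ≤ choi Φ := by
  constructor
  · intro h
    exact h _ (posSemidef_vecMulVec_self_star _).nonneg
  · intro h Z hZ
    obtain ⟨V, rfl⟩ := exists_eq_conjTranspose_mul_self hZ
    have := idTensor_mul_conjTranspose Φ Vᴴ
    rw [conjTranspose_conjTranspose] at this
    rw [this]
    exact Finset.sum_nonneg fun j _ =>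
      ((nonneg_iff_posSemidef.1 h).mul_mul_conjTranspose_same _).nonneg

/-- This is the source of the transpose in the second formula for `R''`. -/
theorem trace_choi_mul_kronecker_one (Φ : Matrix A A ℂ →ₗ[ℂ] Matrix B B ℂ) (X : Matrix A A ℂ) :
    (choi Φ * (X ⊗ₖ (1 : Matrix B B ℂ))).trace = (Φ Xᵀ).trace := by
  simp only [trace, diag_apply, apply_eq_sum_choi, Matrix.mul_apply, kronecker_apply,
    Matrix.one_apply, Fintype.sum_prod_type, mul_ite, mul_one, mul_zero, Finset.sum_ite_eq',
    Finset.mem_univ, if_true, transpose_apply]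
  rw [Finset.sum_comm]
  refine Finset.sum_congr rfl fun b _ => Finset.sum_congr rfl fun k _ =>
    Finset.sum_congr rfl fun l _ => ?_
  ring

theorem isCPTNI_iff (Φ : Matrix A A ℂ →ₗ[ℂ] Matrix B B ℂ) : IsCPTNI Φ ↔ 0 ≤ choi Φ ∧
    ∀ X : Matrix A A ℂ, 0 ≤ X → (choi Φ * (X ⊗ₖ (1 : Matrix B B ℂ))).trace.re ≤ X.trace.re := by
  rw [IsCPTNI, isCP_iff]
  refine and_congr_right fun _ => ⟨fun h X hX => ?_, fun h X hX => ?_⟩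
  · rw [trace_choi_mul_kronecker_one, ← trace_transpose X]
    exact h _ (nonneg_iff_posSemidef.1 hX).transpose.nonneg
  · have := h _ (nonneg_iff_posSemidef.1 hX).transpose.nonneg
    rwa [trace_choi_mul_kronecker_one, transpose_transpose, trace_transpose] at this

theorem IsDensity.trace_re {A : Type*} [Fintype A] {ρ : Matrix A A ℂ} (h : IsDensity ρ) : ρ.trace.re = 1 := by
  rw [h.2, Complex.one_re]

theorem isDensity_of_trace_re {A : Type*} [Fintype A] {ρ : Matrix A A ℂ} (h0 : 0 ≤ ρ) (h : ρ.trace.re = 1) :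
    IsDensity ρ :=
  ⟨h0, by rw [trace_eq_re h0, h, Complex.ofReal_one]⟩

theorem trace_re_le_of_forall_isDensity {P : Matrix (A × B) (A × B) ℂ} {s : ℝ}
    (h : ∀ ρ : Matrix A A ℂ, IsDensity ρ → (P * (ρ ⊗ₖ (1 : Matrix B B ℂ))).trace.re ≤ s)
    {X : Matrix A A ℂ} (hX : 0 ≤ X) :
    (P * (X ⊗ₖ (1 : Matrix B B ℂ))).trace.re ≤ s * X.trace.re := by
  rcases (trace_re_nonneg hX).eq_or_lt with h0 | h0
  · rw [eq_zero_of_nonneg_of_trace_re_le hX h0.symm.le]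
    simp
  · have := h (X.trace.re⁻¹ • X) (isDensity_of_trace_re (smul_nonneg_real (inv_nonneg.2 h0.le) hX)
      (by rw [trace_smul, Complex.smul_re, smul_eq_mul, inv_mul_cancel₀ h0.ne']))
    rw [smul_kronecker, Matrix.mul_smul, trace_smul, Complex.smul_re, smul_eq_mul,
      inv_mul_le_iff₀ h0] at this
    linarith

/-- Divide by `s` and read the result as a Choi operator. For `s = 0` the convention `0⁻¹ = 0` makes
`Λ` the zero map, and testing on the identity gives `Tr P ≤ 0`, so `P = 0`. -/
theorem exists_isCPTNI_choi_eq_smul {P : Matrix (A × B) (A × B) ℂ} (hP : 0 ≤ P) {s : ℝ}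
    (hs : 0 ≤ s)
    (h : ∀ ρ : Matrix A A ℂ, IsDensity ρ → (P * (ρ ⊗ₖ (1 : Matrix B B ℂ))).trace.re ≤ s) :
    ∃ Λ : Matrix A A ℂ →ₗ[ℂ] Matrix B B ℂ, IsCPTNI Λ ∧ P = s • choi Λ := by
  have hX := fun (X : Matrix A A ℂ) (hX : 0 ≤ X) => trace_re_le_of_forall_isDensity h hX
  refine ⟨ofChoi (s⁻¹ • P), (isCPTNI_iff _).2 ?_, ?_⟩ <;> rw [choi_ofChoi]
  · refine ⟨smul_nonneg_real (inv_nonneg.2 hs) hP, fun X hX0 => ?_⟩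
    rw [smul_mul, trace_smul, Complex.smul_re, smul_eq_mul]
    rcases hs.eq_or_lt with rfl | hs
    · simpa using trace_re_nonneg hX0
    · exact (inv_mul_le_iff₀ hs).2 (hX X hX0)
  · rcases hs.eq_or_lt with rfl | hs
    · have := hX 1 PosSemidef.one.nonneg
      rw [one_kronecker_one, mul_one, zero_mul] at this
      rw [eq_zero_of_nonneg_of_trace_re_le hP this, smul_zero, smul_zero]
    · rw [smul_smul, mul_inv_cancel₀ hs.ne', one_smul]

theorem isCompact_setOf_isDensity : IsCompact {ρ : Matrix A A ℂ | IsDensity ρ} :=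
  (isCompact_setOf_nonneg_trace_le (n := A) 1).of_isClosed_subset
    (isClosed_setOf_nonneg.inter (isClosed_eq (by fun_prop) continuous_const))
    fun _ h => ⟨h.1, h.trace_re.le⟩

theorem convex_setOf_isDensity : Convex ℝ {ρ : Matrix A A ℂ | IsDensity ρ} := by
  rintro ρ hρ σ hσ a b ha hb hab
  refine isDensity_of_trace_re (add_nonneg (smul_nonneg_real ha hρ.1) (smul_nonneg_real hb hσ.1)) ?_
  rw [trace_add, trace_smul, trace_smul, Complex.add_re, Complex.smul_re, Complex.smul_re,
    hρ.trace_re, hσ.trace_re, smul_eq_mul, smul_eq_mul, mul_one, mul_one, hab]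

theorem isDensity_maximallyMixed [Nonempty A] :
    IsDensity ((Fintype.card A : ℝ)⁻¹ • (1 : Matrix A A ℂ)) :=
  isDensity_of_trace_re (smul_nonneg_real (by positivity) PosSemidef.one.nonneg) (by
    rw [trace_smul, Complex.smul_re, trace_one, Complex.natCast_re, smul_eq_mul,
      inv_mul_cancel₀ (by simp)])

end QuantumMap

/-! ### The base norm and the three robustnesses -/

namespace QuantumMap

open Matrix

variable {A B : Type*} [Fintype A] [DecidableEq A] [Fintype B] [DecidableEq B]

theorem hsInner_choi {Φ : Matrix A A ℂ →ₗ[ℂ] Matrix B B ℂ} (hΦ : IsHermiticityPreserving Φ)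
    (W : Matrix (A × B) (A × B) ℂ) : hsInner (choi Φ) W = (choi Φ * W).trace := by
  rw [hsInner, hΦ.isHermitian_choi.eq]

theorem IsCPTNI.trace_choi_mul_le {Λ : Matrix A A ℂ →ₗ[ℂ] Matrix B B ℂ} (hΛ : IsCPTNI Λ)
    {W : Matrix (A × B) (A × B) ℂ} {X : Matrix A A ℂ} (hX : 0 ≤ X)
    (hW : W ≤ X ⊗ₖ (1 : Matrix B B ℂ)) : (choi Λ * W).trace.re ≤ X.trace.re :=
  (trace_mul_re_le ((isCPTNI_iff Λ).1 hΛ).1 hW).trans (((isCPTNI_iff Λ).1 hΛ).2 X hX)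

/-- Weak duality: the upper bound on `W` is paired with `Λ₁` and the lower bound with `Λ₂`. -/
theorem trace_choi_mul_le_of_eq_sub {Φ Λ₁ Λ₂ : Matrix A A ℂ →ₗ[ℂ] Matrix B B ℂ}
    (h₁ : IsCPTNI Λ₁) (h₂ : IsCPTNI Λ₂) {s t : ℝ} (hs : 0 ≤ s) (ht : 0 ≤ t)
    (h : Φ = s • Λ₁ - t • Λ₂) {W : Matrix (A × B) (A × B) ℂ} {X Y : Matrix A A ℂ} (hX : 0 ≤ X)
    (hY : 0 ≤ Y) (hXW : -(X ⊗ₖ (1 : Matrix B B ℂ)) ≤ W) (hWY : W ≤ Y ⊗ₖ (1 : Matrix B B ℂ)) :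
    (choi Φ * W).trace.re ≤ s * Y.trace.re + t * X.trace.re := by
  have e1 := mul_le_mul_of_nonneg_left (h₁.trace_choi_mul_le hY hWY) hs
  have e2 := mul_le_mul_of_nonneg_left (h₂.trace_choi_mul_le hX (neg_le.1 hXW)) ht
  rw [mul_neg, trace_neg, Complex.neg_re] at e2
  rw [h, choi_sub, choi_smul, choi_smul, sub_mul, smul_mul, smul_mul, trace_sub, trace_smul,
    trace_smul, Complex.sub_re, Complex.smul_re, Complex.smul_re, smul_eq_mul, smul_eq_mul]
  linarith

theorem exists_isGreatest_isLeast_baseSet [Nonempty A] {Φ : Matrix A A ℂ →ₗ[ℂ] Matrix B B ℂ}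
    (hΦ : IsHermiticityPreserving Φ) :
    ∃ m, IsGreatest {x : ℝ | ∃ (W : Matrix (A × B) (A × B) ℂ) (ρ σ : Matrix A A ℂ),
        IsDensity ρ ∧ IsDensity σ ∧
        -(ρ ⊗ₖ (1 : Matrix B B ℂ)) ≤ W ∧ W ≤ σ ⊗ₖ (1 : Matrix B B ℂ) ∧
        x = (hsInner (choi Φ) W).re} m ∧ IsLeast (baseSet Φ) m := by
  have hmm := isDensity_maximallyMixed (A := A)
  obtain ⟨m, ⟨⟨W, k, hk, h1, h2, h3⟩, hub⟩, P, hP, hJP, hPm⟩ :=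
    exists_isGreatest_and_forall_le (B := B) hΦ.isHermitian_choi
    (K := {ρ : Matrix A A ℂ | IsDensity ρ} ×ˢ {σ : Matrix A A ℂ | IsDensity σ})
    (isCompact_setOf_isDensity.prod isCompact_setOf_isDensity)
    (convex_setOf_isDensity.prod convex_setOf_isDensity) (fun k hk => ⟨hk.1.1, hk.2.1⟩)
    (c := (Fintype.card A : ℝ)⁻¹ + (Fintype.card A : ℝ)⁻¹) (by positivity)
    ⟨(_, _), ⟨hmm, hmm⟩, (add_smul _ _ _).symm⟩ 0
  simp only [zero_mul, sub_zero] at hub h3 hPm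
  have hlow : ∀ x ∈ baseSet Φ, m ≤ x := by
    rintro x ⟨s, t, Λ₁, Λ₂, hs, ht, h₁, h₂, he, rfl⟩
    have := trace_choi_mul_le_of_eq_sub h₁ h₂ hs ht he hk.1.1 hk.2.1 h1 h2
    rwa [IsDensity.trace_re hk.1, IsDensity.trace_re hk.2, mul_one, mul_one, ← h3] at this
  have hmax : ∀ Q : Matrix (A × B) (A × B) ℂ, ∃ σ₀ : Matrix A A ℂ, IsDensity σ₀ ∧
      ∀ σ : Matrix A A ℂ, IsDensity σ → (Q * (σ ⊗ₖ (1 : Matrix B B ℂ))).trace.re ≤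
        (Q * (σ₀ ⊗ₖ (1 : Matrix B B ℂ))).trace.re := by
    intro Q
    have hk : Continuous fun M : Matrix A A ℂ => M ⊗ₖ (1 : Matrix B B ℂ) :=
      continuous_kronecker_one
    obtain ⟨σ₀, h₀, h⟩ := (isCompact_setOf_isDensity (A := A)).exists_isMaxOn
      (f := fun σ => (Q * (σ ⊗ₖ (1 : Matrix B B ℂ))).trace.re) ⟨_, hmm⟩
      (Continuous.continuousOn (by fun_prop))
    exact ⟨σ₀, h₀, fun σ hσ => h hσ⟩
  -- The weights are the separate maxima for `P` and `P - J`. As `K` is a full product, the two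
  -- maximisers form a pair in `K`, so the weights sum to at most `m`.
  obtain ⟨σ₀, hσ₀, hs⟩ := hmax P
  obtain ⟨ρ₀, hρ₀, ht⟩ := hmax (P - choi Φ)
  have hN := sub_nonneg.2 hJP
  have hs0 := trace_mul_re_nonneg hP (kronecker_one_nonneg (m := B) hσ₀.1)
  have ht0 := trace_mul_re_nonneg hN (kronecker_one_nonneg (m := B) hρ₀.1)
  obtain ⟨Λ₁, h₁, hc₁⟩ := exists_isCPTNI_choi_eq_smul hP hs0 hs
  obtain ⟨Λ₂, h₂, hc₂⟩ := exists_isCPTNI_choi_eq_smul hN ht0 ht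
  have hmem : (P * (σ₀ ⊗ₖ (1 : Matrix B B ℂ))).trace.re +
      ((P - choi Φ) * (ρ₀ ⊗ₖ (1 : Matrix B B ℂ))).trace.re ∈ baseSet Φ := by
    refine ⟨_, _, Λ₁, Λ₂, hs0, ht0, h₁, h₂, choi_injective ?_, rfl⟩
    rw [choi_sub, choi_smul, choi_smul, ← hc₁, ← hc₂, sub_sub_cancel]
  refine ⟨m, ⟨⟨W, k.1, k.2, hk.1, hk.2, h1, h2, by rw [hsInner_choi hΦ, h3]⟩, ?_⟩, ?_, hlow⟩
  · rintro x ⟨W, ρ, σ, hρ, hσ, h4, h5, rfl⟩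
    exact hub ⟨W, (ρ, σ), ⟨hρ, hσ⟩, h4, h5, by rw [hsInner_choi hΦ]⟩
  · rwa [le_antisymm (hPm (ρ₀, σ₀) ⟨hρ₀, hσ₀⟩) (hlow _ hmem)] at hmem

theorem exists_isGreatest_isLeast_robSet [Nonempty A] {Φ : Matrix A A ℂ →ₗ[ℂ] Matrix B B ℂ}
    (hΦ : IsHermiticityPreserving Φ) :
    ∃ m, IsGreatest {x : ℝ | ∃ (W : Matrix (A × B) (A × B) ℂ) (X Y : Matrix A A ℂ),
        0 ≤ X ∧ 0 ≤ Y ∧ (X + Y).trace = 1 ∧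
        -(X ⊗ₖ (1 : Matrix B B ℂ)) ≤ W ∧ W ≤ Y ⊗ₖ (1 : Matrix B B ℂ) ∧
        x = (hsInner (choi Φ) W).re - Y.trace.re} m ∧ IsLeast (robSet Φ) m := by
  have hmm := isDensity_maximallyMixed (A := A)
  have hKc : IsCompact {k : Matrix A A ℂ × Matrix A A ℂ |
      (0 ≤ k.1 ∧ 0 ≤ k.2) ∧ IsDensity (k.1 + k.2)} := by
    refine ((isCompact_setOf_nonneg_trace_le (n := A) 1).prod
      (isCompact_setOf_nonneg_trace_le (n := A) 1)).of_isClosed_subset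
      (((isClosed_setOf_nonneg.preimage continuous_fst).inter
        (isClosed_setOf_nonneg.preimage continuous_snd)).inter
        (isCompact_setOf_isDensity.isClosed.preimage (continuous_fst.add continuous_snd))) ?_
    rintro k ⟨⟨h1, h2⟩, h3⟩
    have h4 := h3.trace_re
    rw [trace_add, Complex.add_re] at h4
    have h5 := trace_re_nonneg h1
    have h6 := trace_re_nonneg h2
    exact ⟨⟨h1, by linarith⟩, ⟨h2, by linarith⟩⟩
  have hKconv : Convex ℝ {k : Matrix A A ℂ × Matrix A A ℂ |
      (0 ≤ k.1 ∧ 0 ≤ k.2) ∧ IsDensity (k.1 + k.2)} := by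
    rintro k ⟨⟨h1, h2⟩, h3⟩ l ⟨⟨h4, h5⟩, h6⟩ a b ha hb hab
    refine ⟨⟨add_nonneg (smul_nonneg_real ha h1) (smul_nonneg_real hb h4),
      add_nonneg (smul_nonneg_real ha h2) (smul_nonneg_real hb h5)⟩, ?_⟩
    have hab' : IsDensity (a • (k.1 + k.2) + b • (l.1 + l.2)) :=
      convex_setOf_isDensity h3 h6 ha hb hab
    have heq : a • (k.1 + k.2) + b • (l.1 + l.2) = (a • k + b • l).1 + (a • k + b • l).2 := by
      simp only [Prod.fst_add, Prod.snd_add, Prod.smul_fst, Prod.smul_snd]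
      module
    rwa [heq] at hab'
  obtain ⟨m, ⟨⟨W, k, hk, h1, h2, h3⟩, hub⟩, P, hP, hJP, hPm⟩ :=
    exists_isGreatest_and_forall_le (B := B) hΦ.isHermitian_choi hKc hKconv (fun k hk => hk.1)
    (c := (Fintype.card A : ℝ)⁻¹) (by positivity)
    ⟨(0, _), ⟨⟨le_rfl, hmm.1⟩, by rwa [zero_add]⟩, zero_add _⟩ 1
  simp only [one_mul] at hub h3 hPm
  have hN := sub_nonneg.2 hJP
  -- The pairs `(0, ρ)` and `(ρ, 0)` of `K` separate the joint bound into the weight `1 + m` for `P`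
  -- and the weight `m` for `P - J`; the extra `1` comes from the term `Tr Y`.
  have hP1 : ∀ ρ : Matrix A A ℂ, IsDensity ρ →
      (P * (ρ ⊗ₖ (1 : Matrix B B ℂ))).trace.re ≤ 1 + m := by
    intro ρ hρ
    have := hPm (0, ρ) ⟨⟨le_rfl, hρ.1⟩, by rwa [zero_add]⟩
    simp only [zero_kronecker, mul_zero, trace_zero, Complex.zero_re, add_zero,
      hρ.trace_re] at this
    linarith
  have hN1 : ∀ ρ : Matrix A A ℂ, IsDensity ρ →
      ((P - choi Φ) * (ρ ⊗ₖ (1 : Matrix B B ℂ))).trace.re ≤ m := by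
    intro ρ hρ
    have := hPm (ρ, 0) ⟨⟨hρ.1, le_rfl⟩, by rwa [add_zero]⟩
    simpa only [zero_kronecker, mul_zero, trace_zero, Complex.zero_re, zero_add, sub_zero]
      using this
  have hm : 0 ≤ m := (trace_mul_re_nonneg hN (kronecker_one_nonneg (m := B) hmm.1)).trans
    (hN1 _ hmm)
  obtain ⟨Λ₁, h₁, hc₁⟩ := exists_isCPTNI_choi_eq_smul hP (by linarith) hP1
  obtain ⟨Λ₂, h₂, hc₂⟩ := exists_isCPTNI_choi_eq_smul hN hm hN1
  have hsum : Φ + m • Λ₂ = (1 + m) • Λ₁ := choi_injective (by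
    rw [choi_add, choi_smul, choi_smul, ← hc₁, ← hc₂, add_sub_cancel])
  refine ⟨m, ⟨⟨W, k.1, k.2, hk.1.1, hk.1.2, hk.2.2, h1, h2, by rw [hsInner_choi hΦ, h3]⟩, ?_⟩,
    ⟨hm, Λ₂, h₂, ?_⟩, ?_⟩
  · rintro x ⟨W, X, Y, hX, hY, hXY, h4, h5, rfl⟩
    exact hub ⟨W, (X, Y), ⟨⟨hX, hY⟩, add_nonneg hX hY, hXY⟩, h4, h5, by rw [hsInner_choi hΦ]⟩
  · rwa [hsum, smul_smul, inv_mul_cancel₀ (by linarith), one_smul]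
  · rintro r ⟨hr, Λ, hΛ, hΛ'⟩
    -- A feasible `r` is a decomposition with weights `1 + r` and `r`. Weak duality minus `Tr Y`
    -- then leaves `r * Tr (X + Y) = r`.
    have he : Φ = (1 + r) • ((1 + r)⁻¹ • (Φ + r • Λ)) - r • Λ := by
      rw [smul_smul, mul_inv_cancel₀ (by linarith), one_smul, add_sub_cancel_right]
    have h4 := trace_choi_mul_le_of_eq_sub hΛ' hΛ (by linarith) hr he hk.1.1 hk.1.2 h1 h2
    have h5 := hk.2.trace_re
    rw [trace_add, Complex.add_re] at h5
    rw [h3]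
    linear_combination h4 + r * h5

theorem exists_isGreatest_isLeast_robSet' [Nonempty A] {Φ : Matrix A A ℂ →ₗ[ℂ] Matrix B B ℂ}
    (hΦ : IsHermiticityPreserving Φ) :
    ∃ m, IsGreatest {x : ℝ | ∃ (W : Matrix (A × B) (A × B) ℂ) (ρ : Matrix A A ℂ),
        IsDensity ρ ∧ 0 ≤ W ∧ W ≤ ρ ⊗ₖ (1 : Matrix B B ℂ) ∧
        x = (hsInner (choi Φ) W).re - 1} m ∧ IsLeast (robSet' Φ) m := by
  have hmm := isDensity_maximallyMixed (A := A)
  obtain ⟨m, ⟨⟨W, k, hk, h1, h2, h3⟩, hub⟩, P, hP, hJP, hPm⟩ :=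
    exists_isGreatest_and_forall_le (B := B) hΦ.isHermitian_choi
    -- Fixing `X = 0` leaves `P - J` merely positive, with no bound on its trace; the coefficient `a
    -- = 1` supplies the `-1`, because `Tr ρ = 1`.
    (K := {0} ×ˢ {σ : Matrix A A ℂ | IsDensity σ})
    (isCompact_singleton.prod isCompact_setOf_isDensity)
    ((convex_singleton 0).prod convex_setOf_isDensity)
    (fun k hk => ⟨(show k.1 = 0 from hk.1).ge, hk.2.1⟩)
    (c := (Fintype.card A : ℝ)⁻¹) (by positivity) ⟨(0, _), ⟨rfl, hmm⟩, zero_add _⟩ 1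
  obtain ⟨k₁, ρ⟩ := k
  obtain ⟨rfl : k₁ = 0, hρ : IsDensity ρ⟩ := hk
  simp only [zero_kronecker, neg_zero, one_mul, hρ.trace_re] at h1 h2 h3
  have hP1 : ∀ ρ : Matrix A A ℂ, IsDensity ρ →
      (P * (ρ ⊗ₖ (1 : Matrix B B ℂ))).trace.re ≤ 1 + m := by
    intro ρ hρ
    have := hPm (0, ρ) ⟨rfl, hρ⟩
    simp only [zero_kronecker, mul_zero, trace_zero, Complex.zero_re, add_zero,
      hρ.trace_re, mul_one] at this
    linarith
  have hm : 0 ≤ 1 + m := (trace_mul_re_nonneg hP (kronecker_one_nonneg (m := B) hmm.1)).trans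
    (hP1 _ hmm)
  obtain ⟨Λ, hΛ, hc⟩ := exists_isCPTNI_choi_eq_smul hP hm hP1
  refine ⟨m, ⟨⟨W, ρ, hρ, h1, h2, by rw [hsInner_choi hΦ, h3]⟩, ?_⟩, ⟨hm, Λ, hΛ, hc ▸ hJP⟩, ?_⟩
  · rintro x ⟨W, ρ, hρ, h4, h5, rfl⟩
    exact hub ⟨W, (0, ρ), ⟨rfl, hρ⟩, by simpa using h4, h5, by
      rw [hsInner_choi hΦ, hρ.trace_re, one_mul]⟩
  · rintro r ⟨hr, Λ, hΛ, hle⟩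
    -- Weak duality: `⟨J, W⟩ ≤ (1 + r) ⟨choi Λ, W⟩ ≤ 1 + r`, the first inequality by `W ≥ 0`.
    have h4 := mul_le_mul_of_nonneg_left (hΛ.trace_choi_mul_le hρ.1 h2) hr
    have h5 := trace_mul_re_le h1 hle
    rw [trace_mul_comm, trace_mul_comm W, smul_mul, trace_smul, Complex.smul_re, smul_eq_mul] at h5
    rw [hρ.trace_re] at h4
    rw [h3]
    linarith

theorem IsHermiticityPreserving.neg {Φ : Matrix A A ℂ →ₗ[ℂ] Matrix B B ℂ}
    (hΦ : IsHermiticityPreserving Φ) : IsHermiticityPreserving (-Φ) := fun X hX => (hΦ X hX).neg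

theorem mem_robSet''_iff [Nonempty A] {Φ : Matrix A A ℂ →ₗ[ℂ] Matrix B B ℂ} {r : ℝ} :
    r ∈ robSet'' Φ ↔ r - 1 ∈ robSet' (-Φ) := by
  simp only [robSet'', robSet', Set.mem_ofPred_eq, add_sub_cancel, isCP_iff, choi_add, choi_neg,
    choi_smul, neg_le_iff_add_nonneg']

/-- `R''(Φ) = R'(-Φ) + 1`, since `Φ + r Λ` is completely positive exactly when `-J ≤ r • choi Λ`. On
the dual side `W` is replaced by `ρ ⊗ 1 - W`. -/
theorem exists_isGreatest_isLeast_robSet'' [Nonempty A] {Φ : Matrix A A ℂ →ₗ[ℂ] Matrix B B ℂ}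
    (hΦ : IsHermiticityPreserving Φ) :
    ∃ m, IsGreatest {x : ℝ | ∃ (W : Matrix (A × B) (A × B) ℂ) (ρ : Matrix A A ℂ),
        IsDensity ρ ∧ 0 ≤ W ∧ W ≤ ρ ⊗ₖ (1 : Matrix B B ℂ) ∧
        x = (hsInner (choi Φ) (W - ρ ⊗ₖ (1 : Matrix B B ℂ))).re} m ∧ IsLeast (robSet'' Φ) m := by
  obtain ⟨m, ⟨⟨W, ρ, hρ, h1, h2, h3⟩, hub⟩, hmem, hlow⟩ := exists_isGreatest_isLeast_robSet' hΦ.neg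
  have hval : ∀ V : Matrix (A × B) (A × B) ℂ,
      (hsInner (choi (-Φ)) V).re = -(hsInner (choi Φ) V).re := fun V => by
    rw [hsInner_choi hΦ.neg, hsInner_choi hΦ, choi_neg, neg_mul, trace_neg, Complex.neg_re]
  have hneg : ∀ V : Matrix (A × B) (A × B) ℂ,
      (hsInner (choi Φ) (-V)).re = -(hsInner (choi Φ) V).re := fun V => by
    rw [hsInner_choi hΦ, hsInner_choi hΦ, mul_neg, trace_neg, Complex.neg_re]
  refine ⟨m + 1, ⟨⟨ρ ⊗ₖ 1 - W, ρ, hρ, sub_nonneg.2 h2, sub_le_self _ h1, ?_⟩, ?_⟩, ?_, ?_⟩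
  · rw [sub_sub_cancel_left, hneg, h3, hval]
    ring
  · rintro x ⟨V, σ, hσ, h4, h5, rfl⟩
    have := hub ⟨σ ⊗ₖ 1 - V, σ, hσ, sub_nonneg.2 h5, sub_le_self _ h4, rfl⟩
    rw [hval, ← hneg, neg_sub] at this
    linarith
  · rwa [mem_robSet''_iff, add_sub_cancel_right]
  · intro r hr
    have := hlow (mem_robSet''_iff.1 hr)
    linarith

theorem hsInner_choi_sub_kronecker_one {Φ : Matrix A A ℂ →ₗ[ℂ] Matrix B B ℂ}
    (hΦ : IsHermiticityPreserving Φ) (W : Matrix (A × B) (A × B) ℂ) (ρ : Matrix A A ℂ) :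
    (hsInner (choi Φ) (W - ρ ⊗ₖ (1 : Matrix B B ℂ))).re =
      (hsInner (choi Φ) W).re - (Φ ρ.transpose).trace.re := by
  rw [hsInner_choi hΦ, hsInner_choi hΦ, mul_sub, trace_sub, trace_choi_mul_kronecker_one,
    Complex.sub_re]

/-! ### The diamond norm -/

theorem IsHermiticityPreserving.isHermitian_idTensor {Φ : Matrix A A ℂ →ₗ[ℂ] Matrix B B ℂ}
    (hΦ : IsHermiticityPreserving Φ) {Z : Matrix (A × A) (A × A) ℂ} (hZ : 0 ≤ Z) :
    (idTensor Φ Z).IsHermitian := by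
  obtain ⟨V, rfl⟩ := exists_eq_conjTranspose_mul_self hZ
  have := idTensor_mul_conjTranspose Φ Vᴴ
  rw [conjTranspose_conjTranspose] at this
  rw [this, IsHermitian, conjTranspose_sum]
  simp only [conjTranspose_mul, conjTranspose_conjTranspose, hΦ.isHermitian_choi.eq, mul_assoc]

/-- The products `(|H| + H)(1 - S)` and `(|H| - H)(1 + S)` have nonnegative traces, which add up to
`2 (Tr |H| - Tr H S)`. -/
theorem trace_mul_le_traceNorm {H S : Matrix A A ℂ} (hH : H.IsHermitian) (h1 : -1 ≤ S)
    (h2 : S ≤ 1) : (H * S).trace.re ≤ traceNorm H := by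
  obtain ⟨ha, hb⟩ := hH.le_abs
  have h4 := trace_mul_re_nonneg (neg_le_iff_add_nonneg.1 hb) (sub_nonneg.2 h2)
  have h5 := trace_mul_re_nonneg (sub_nonneg.2 ha) (neg_le_iff_add_nonneg.1 h1)
  have h6 : traceNorm H = (CFC.abs H).trace.re := rfl
  rw [h6]
  simp only [add_mul, sub_mul, mul_add, mul_sub, mul_one, trace_add, trace_sub, Complex.add_re,
    Complex.sub_re] at h4 h5
  linarith

theorem exists_isGreatest_diamondSet [Nonempty A] {Φ : Matrix A A ℂ →ₗ[ℂ] Matrix B B ℂ}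
    (hΦ : IsHermiticityPreserving Φ) :
    ∃ m, IsGreatest {x : ℝ | ∃ (W : Matrix (A × B) (A × B) ℂ) (ρ : Matrix A A ℂ),
        IsDensity ρ ∧ -(ρ ⊗ₖ (1 : Matrix B B ℂ)) ≤ W ∧ W ≤ ρ ⊗ₖ (1 : Matrix B B ℂ) ∧
        x = (hsInner (choi Φ) W).re} m ∧ IsGreatest (diamondSet Φ) m := by
  have hmm := isDensity_maximallyMixed (A := A)
  obtain ⟨m, ⟨⟨W, k, hk, h1, h2, h3⟩, hub⟩, -⟩ :=
    exists_isGreatest_and_forall_le (B := B) hΦ.isHermitian_choi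
    (K := (fun ρ : Matrix A A ℂ => (ρ, ρ)) '' {σ : Matrix A A ℂ | IsDensity σ})
    (isCompact_setOf_isDensity.image (by fun_prop))
    (convex_setOf_isDensity.is_linear_image
      ((LinearMap.id (R := ℝ) (M := Matrix A A ℂ)).prod LinearMap.id).isLinear)
    (by rintro k ⟨ρ, hρ, rfl⟩; exact ⟨hρ.1, hρ.1⟩)
    (c := (Fintype.card A : ℝ)⁻¹ + (Fintype.card A : ℝ)⁻¹) (by positivity)
    ⟨(_, _), ⟨_, hmm, rfl⟩, (add_smul _ _ _).symm⟩ 0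
  obtain ⟨ρ, hρ : IsDensity ρ, rfl⟩ := hk
  simp only [zero_mul, sub_zero] at hub h1 h2 h3
  -- The sign `S` of the output realises its trace norm. The vectors composing `Z` give matrices `M
  -- j`, and `∑ (M j ⊗ 1)† S (M j ⊗ 1)` is dual feasible for the density `∑ (M j)† M j`, with the
  -- same value.
  have hup : ∀ x ∈ diamondSet Φ, x ≤ m := by
    rintro x ⟨Z, hZ, rfl⟩
    obtain ⟨S, hS1, hS2, hS⟩ := (hΦ.isHermitian_idTensor hZ.1).exists_mul_eq_abs
    have hx : traceNorm (idTensor Φ Z) = (idTensor Φ Z * S).trace.re := by rw [hS]; rfl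
    obtain ⟨V, hV⟩ := exists_eq_conjTranspose_mul_self hZ.1
    set M : A × A → Matrix A A ℂ := fun j => Matrix.of fun a k => Vᴴ (a, k) j with hM
    have hid : idTensor Φ Z = ∑ j, (M j ⊗ₖ (1 : Matrix B B ℂ)) * choi Φ *
        (M j ⊗ₖ (1 : Matrix B B ℂ))ᴴ := by
      rw [hV]
      have := idTensor_mul_conjTranspose Φ Vᴴ
      rwa [conjTranspose_conjTranspose] at this
    have hsum : (∑ j, (M j)ᴴ * M j) ⊗ₖ (1 : Matrix B B ℂ) =
        ∑ j, (M j ⊗ₖ (1 : Matrix B B ℂ))ᴴ * 1 * (M j ⊗ₖ (1 : Matrix B B ℂ)) := by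
      have hadd : ∀ s : Finset (A × A), (∑ j ∈ s, (M j)ᴴ * M j) ⊗ₖ (1 : Matrix B B ℂ) =
          ∑ j ∈ s, ((M j)ᴴ * M j) ⊗ₖ (1 : Matrix B B ℂ) := fun s => by
        induction s using Finset.cons_induction with
        | empty => simp
        | cons j s hj ih => rw [Finset.sum_cons, Finset.sum_cons, add_kronecker, ih]
      rw [hadd]
      refine Finset.sum_congr rfl fun j _ => ?_
      rw [mul_one, conjTranspose_kronecker, conjTranspose_one, ← mul_kronecker_mul, mul_one]
    have hd : IsDensity (∑ j, (M j)ᴴ * M j) := by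
      refine ⟨Finset.sum_nonneg fun j _ => (posSemidef_conjTranspose_mul_self (M j)).nonneg, ?_⟩
      rw [← hZ.2, hV, trace_sum, trace_mul_comm]
      simp only [hM, trace, diag_apply, Matrix.mul_apply, conjTranspose_apply, Matrix.of_apply,
        Fintype.sum_prod_type, star_star]
      refine Finset.sum_congr rfl fun j _ => Finset.sum_congr rfl fun j' _ => ?_
      exact Finset.sum_comm
    rw [hx]
    refine hub ⟨∑ j, (M j ⊗ₖ (1 : Matrix B B ℂ))ᴴ * S * (M j ⊗ₖ (1 : Matrix B B ℂ)), (_, _),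
      ⟨_, hd, rfl⟩, ?_, ?_, ?_⟩
    · rw [hsum, ← Finset.sum_neg_distrib]
      refine Finset.sum_le_sum fun j _ => ?_
      simpa using conj_le_conj hS1 (M j ⊗ₖ (1 : Matrix B B ℂ))
    · rw [hsum]
      exact Finset.sum_le_sum fun j _ => conj_le_conj hS2 _
    · rw [hid, Finset.sum_mul, Finset.mul_sum, trace_sum, trace_sum]
      congr 1
      refine Finset.sum_congr rfl fun j _ => ?_
      rw [mul_assoc, mul_assoc, trace_mul_comm]
      simp only [mul_assoc]
  refine ⟨m, ⟨⟨W, ρ, hρ, h1, h2, by rw [hsInner_choi hΦ, h3]⟩, ?_⟩, ?_, hup⟩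
  · rintro x ⟨W, ρ, hρ, h4, h5, rfl⟩
    exact hub ⟨W, (ρ, ρ), ⟨ρ, hρ, rfl⟩, h4, h5, by rw [hsInner_choi hΦ]⟩
  · obtain ⟨M, S, hM, hS1, hS2, hW⟩ := exists_eq_conj_kronecker hρ.1 h1 h2
    -- The optimal input is the pure state whose vector is `M` reshaped; it is normalised because
    -- `Tr M† M = Tr ρ = 1`.
    set R : Matrix (A × A) Unit ℂ := Matrix.of fun p _ => M p.1 p.2 with hR
    have hd : IsDensity (R * Rᴴ) := by
      refine ⟨(posSemidef_self_mul_conjTranspose R).nonneg, ?_⟩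
      rw [← hρ.2, ← hM, trace_mul_comm]
      simp only [hR, trace, diag_apply, Matrix.mul_apply, conjTranspose_apply, Matrix.of_apply,
        Fintype.sum_prod_type, Finset.univ_unique, Finset.sum_singleton]
      exact Finset.sum_comm
    have hid : idTensor Φ (R * Rᴴ) = (M ⊗ₖ (1 : Matrix B B ℂ)) * choi Φ *
        (M ⊗ₖ (1 : Matrix B B ℂ))ᴴ := by
      rw [idTensor_mul_conjTranspose]
      simp only [Finset.univ_unique, Finset.sum_singleton]
      rfl
    have hmem : traceNorm (idTensor Φ (R * Rᴴ)) ∈ diamondSet Φ := ⟨_, hd, rfl⟩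
    have hle : m ≤ traceNorm (idTensor Φ (R * Rᴴ)) := by
      refine le_trans (le_of_eq ?_)
        (trace_mul_le_traceNorm (hΦ.isHermitian_idTensor hd.1) hS1 hS2)
      rw [h3, hW, hid]
      simp only [mul_assoc]
      rw [trace_mul_comm (M ⊗ₖ (1 : Matrix B B ℂ))]
      simp only [mul_assoc]
    rwa [le_antisymm (hup _ hmem) hle] at hmem

end QuantumMap

theorem proposition3 {A B : Type*} [Fintype A] [DecidableEq A] [Nonempty A]
    [Fintype B] [DecidableEq B]
    (Φ : Matrix A A ℂ →ₗ[ℂ] Matrix B B ℂ) (hΦ : IsHermiticityPreserving Φ) :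
    -- the extrema that define the five quantities are attained
    (IsGreatest (diamondSet Φ) (diamondNorm Φ) ∧ IsLeast (baseSet Φ) (baseNorm Φ) ∧
      IsLeast (robSet Φ) (rob Φ) ∧ IsLeast (robSet' Φ) (rob' Φ) ∧
      IsLeast (robSet'' Φ) (rob'' Φ)) ∧
    -- the diamond norm
    IsGreatest {x : ℝ | ∃ (W : Matrix (A × B) (A × B) ℂ) (ρ : Matrix A A ℂ),
        IsDensity ρ ∧ -(ρ ⊗ₖ (1 : Matrix B B ℂ)) ≤ W ∧ W ≤ ρ ⊗ₖ (1 : Matrix B B ℂ) ∧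
        x = (hsInner (choi Φ) W).re} (diamondNorm Φ) ∧
    -- the base norm
    IsGreatest {x : ℝ | ∃ (W : Matrix (A × B) (A × B) ℂ) (ρ σ : Matrix A A ℂ),
        IsDensity ρ ∧ IsDensity σ ∧
        -(ρ ⊗ₖ (1 : Matrix B B ℂ)) ≤ W ∧ W ≤ σ ⊗ₖ (1 : Matrix B B ℂ) ∧
        x = (hsInner (choi Φ) W).re} (baseNorm Φ) ∧
    -- the robustness `R`
    IsGreatest {x : ℝ | ∃ (W : Matrix (A × B) (A × B) ℂ) (X Y : Matrix A A ℂ),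
        0 ≤ X ∧ 0 ≤ Y ∧ (X + Y).trace = 1 ∧
        -(X ⊗ₖ (1 : Matrix B B ℂ)) ≤ W ∧ W ≤ Y ⊗ₖ (1 : Matrix B B ℂ) ∧
        x = (hsInner (choi Φ) W).re - Y.trace.re} (rob Φ) ∧
    -- the robustness `R'`
    IsGreatest {x : ℝ | ∃ (W : Matrix (A × B) (A × B) ℂ) (ρ : Matrix A A ℂ),
        IsDensity ρ ∧ 0 ≤ W ∧ W ≤ ρ ⊗ₖ (1 : Matrix B B ℂ) ∧
        x = (hsInner (choi Φ) W).re - 1} (rob' Φ) ∧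
    -- the robustness `R''`, in two forms
    IsGreatest {x : ℝ | ∃ (W : Matrix (A × B) (A × B) ℂ) (ρ : Matrix A A ℂ),
        IsDensity ρ ∧ 0 ≤ W ∧ W ≤ ρ ⊗ₖ (1 : Matrix B B ℂ) ∧
        x = (hsInner (choi Φ) (W - ρ ⊗ₖ (1 : Matrix B B ℂ))).re} (rob'' Φ) ∧
    IsGreatest {x : ℝ | ∃ (W : Matrix (A × B) (A × B) ℂ) (ρ : Matrix A A ℂ),
        IsDensity ρ ∧ 0 ≤ W ∧ W ≤ ρ ⊗ₖ (1 : Matrix B B ℂ) ∧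
        x = (hsInner (choi Φ) W).re - (Φ ρ.transpose).trace.re} (rob'' Φ) := by
  obtain ⟨d, hd, hd'⟩ := exists_isGreatest_diamondSet hΦ
  obtain ⟨b, hb, hb'⟩ := exists_isGreatest_isLeast_baseSet hΦ
  obtain ⟨r, hr, hr'⟩ := exists_isGreatest_isLeast_robSet hΦ
  obtain ⟨r₁, hr₁, hr₁'⟩ := exists_isGreatest_isLeast_robSet' hΦ
  obtain ⟨r₂, hr₂, hr₂'⟩ := exists_isGreatest_isLeast_robSet'' hΦ
  -- Attainment identifies the suprema and infima in the definitions with the common optimal values.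
  rw [diamondNorm, baseNorm, rob, rob', rob'', hd'.csSup_eq, hb'.csInf_eq, hr'.csInf_eq,
    hr₁'.csInf_eq, hr₂'.csInf_eq]
  refine ⟨⟨hd', hb', hr', hr₁', hr₂'⟩, hd, hb, hr, hr₁, hr₂, ?_⟩
  simpa only [hsInner_choi_sub_kronecker_one hΦ] using hr₂
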